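/- **Lemma.** Let $d\in\mathbb N$, $1\le s\le s_\phi$ be integers, and let $\mathscr H_\phi$ be a reproducing kernel Hilbert space of real functions on $\mathbb R^d$ with kernel $k_\phi\in C^{s_\phi,s_\phi}(\mathbb R^d\times\mathbb R^d,\mathbb R)$, meaning that $\partial_x^{\alpha}\partial_y^{\alpha}k_\phi$ exists and is continuous for all multi-indices $\alpha\in\mathbb N^d$ with $|\alpha|\le s_\phi$. Write $\phi(x)=k_\phi(\cdot,x)\in\mathscr H_\phi$. Let $S\subset\mathbb R^d$ be bounded, $r>0$, and let $\Omega$ be the union of the open balls (or the union of the closed balls) of radius $r$ centered at the points of $S$. Let $x_1,\dots,x_M\in\Omega$, $M\ge1$, have fill distance $$h:=\sup_{x\in\Omega}\min_{1\le m\le M}\|x-x_m\|\le r\,\min\Bigl(1,\frac1{18(s-1)^2}\Bigr),$$ where $\|\cdot\|$ is the Euclidean norm and the condition reads $h\le r$ if $s=1$. Let $g\in C^s(\mathbb R^d,\mathbb R)$, and suppose there are a positive semidefinite trace-class operator $A$ on $\mathscr H_\phi$ and $\tau\ge0$ such that $$|g(x_m)-\langle\phi(x_m),A\phi(x_m)\rangle_{\mathscr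 H_\phi}|\le\tau\qquad\text{for all } m\in\{1,\dots,M\}.$$ Then $$g(x)\ge-(C\,h^s+2\tau)\qquad\text{for all } x\in\overline\Omega,$$ where $$C=C_0\bigl(|g|_{\Omega,s}+2^sD_{\Omega,s}^2\operatorname{tr}(A)\bigr),\qquad C_0=3\,\frac{\max\bigl(\sqrt d,\;3\sqrt{2d}\,(s-1)\bigr)^{2s}}{s!},$$ $$|g|_{\Omega,s}=\sup_{x\in\Omega}\max_{|\alpha|=s}|\partial^\alpha g(x)|,\qquad D_{\Omega,s}^2=\sup_{x,y\in\Omega}\max_{|\alpha|\le s}|\partial_x^\alpha\partial_y^\alpha k_\phi(x,y)|,$$ a maximum over the empty set being $0$. -/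

import Mathlib

/-- `ℝ^d` with its Euclidean norm. -/
abbrev Rd (d : ℕ) : Type := EuclideanSpace ℝ (Fin d)

/-- Iterated directional derivative `∂_{v₁} ∂_{v₂} ⋯ ∂_{vₙ} f` along the list `[v₁, …, vₙ]`;
the last direction is differentiated first. -/
noncomputable def iterLineDeriv {V : Type*} [AddCommGroup V] [Module ℝ V] :
    List V → (V → ℝ) → V → ℝ
  | [], f => f
  | v :: l, f => fun p => lineDeriv ℝ (iterLineDeriv l f) p v

/-- All the successive directional derivatives entering `iterLineDeriv l f` exist, at every
point. -/
def IterLineDifferentiable {V : Type*} [AddCommGroup V] [Module ℝ V] :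
    List V → (V → ℝ) → Prop
  | [], _ => True
  | v :: l, f =>
      IterLineDifferentiable l f ∧ ∀ p, LineDifferentiableAt ℝ (iterLineDeriv l f) p v

/-- The list of directions `e₁, …, e₁, e₂, …, e₂, …, e_d, …, e_d` of the multi-index `α`,
where `eᵢ` is repeated `αᵢ` times. -/
noncomputable def multiDirs {d : ℕ} (α : Fin d → ℕ) : List (Rd d) :=
  (List.finRange d).flatMap fun i => List.replicate (α i) (EuclideanSpace.single i (1 : ℝ))

/-- The partial derivative `∂^α g = ∂^{|α|} g / ∂x₁^{α₁} ⋯ ∂x_d^{α_d}`. -/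
noncomputable def partialDeriv {d : ℕ} (α : Fin d → ℕ) (g : Rd d → ℝ) : Rd d → ℝ :=
  iterLineDeriv (multiDirs α) g

/-- The directions, in `ℝ^d × ℝ^d`, of the differential operator `∂_x^α ∂_y^α`. -/
noncomputable def diagDirs {d : ℕ} (α : Fin d → ℕ) : List (Rd d × Rd d) :=
  (multiDirs α).map (fun v => (v, 0)) ++ (multiDirs α).map (fun v => (0, v))

/-- The mixed partial derivative `(x, y) ↦ ∂_x^α ∂_y^α k(x, y)`. -/
noncomputable def diagDeriv {d : ℕ} (α : Fin d → ℕ) (k : Rd d → Rd d → ℝ) :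
    Rd d × Rd d → ℝ :=
  iterLineDeriv (diagDirs α) fun p => k p.1 p.2

/-- The class `C^{s,s}(ℝ^d × ℝ^d, ℝ)`: for every multi-index `α` of order `|α| ≤ s`, the partial
derivative `∂_x^α ∂_y^α k` exists everywhere and is continuous. -/
def IsDiagC {d : ℕ} (s : ℕ) (k : Rd d → Rd d → ℝ) : Prop :=
  ∀ α : Fin d → ℕ, ∑ i, α i ≤ s →
    IterLineDifferentiable (diagDirs α) (fun p : Rd d × Rd d => k p.1 p.2) ∧
      Continuous (diagDeriv α k)

/-- Fill distance `h_{X,Ω} = sup_{x ∈ Ω} min_m ‖x - x_m‖` (used for `0 < M` and bounded `Ω`). -/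
noncomputable def fillDistance {d M : ℕ} (X : Fin M → Rd d) (Ω : Set (Rd d)) : ℝ :=
  sSup ((fun x => ⨅ m, ‖x - X m‖) '' Ω)

/-- The seminorm `|g|_{Ω,s} = sup_{x ∈ Ω} max_{|α| = s} |∂^α g(x)|`
(used for `g` of class `C^s` on `ℝ^d` and bounded `Ω`, so that the supremum is finite). -/
noncomputable def derivSeminorm {d : ℕ} (Ω : Set (Rd d)) (s : ℕ) (g : Rd d → ℝ) : ℝ :=
  sSup {t | ∃ x ∈ Ω, ∃ α : Fin d → ℕ, ∑ i, α i = s ∧ t = |partialDeriv α g x|}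

/-- The quantity `D²_{Ω,s} = sup_{x,y ∈ Ω} max_{|α| ≤ s} |∂_x^α ∂_y^α k(x, y)|`
(used for `k` of class `C^{s,s}` and bounded `Ω`, so that the supremum is finite). -/
noncomputable def kernelDerivBoundSq {d : ℕ} (Ω : Set (Rd d)) (s : ℕ)
    (k : Rd d → Rd d → ℝ) : ℝ :=
  sSup {t | ∃ x ∈ Ω, ∃ y ∈ Ω, ∃ α : Fin d → ℕ, ∑ i, α i ≤ s ∧ t = |diagDeriv α k (x, y)|}

section Kernel

variable {d : ℕ} (H : Type*) [NormedAddCommGroup H] [InnerProductSpace ℝ H] [CompleteSpace H]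
  [RKHS ℝ H (Rd d) ℝ]

/-- The feature map `φ(x) = k(·, x) ∈ H` of a reproducing kernel Hilbert space `H` of
real-valued functions on `ℝ^d`. -/
noncomputable def featureMap (x : Rd d) : H := RKHS.kerFun H x 1

/-- The real-valued reproducing kernel `k` of `H`. -/
noncomputable def scalarKernel (x y : Rd d) : ℝ := RKHS.kernel H x y 1

/-- `k(x, y) = ⟨φ(x), φ(y)⟩`. -/
theorem scalarKernel_eq_inner (x y : Rd d) :
    scalarKernel H x y = inner ℝ (featureMap H x) (featureMap H y) := by
  have h := RKHS.kernel_inner H x y (1 : ℝ) (1 : ℝ)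
  rw [real_inner_comm, scalarKernel, featureMap, featureMap, ← h]
  exact (one_mul _).symm

end Kernel

/-- A positive operator `A` is trace class if `∑ᵢ ⟨eᵢ, A eᵢ⟩ < ∞` for a Hilbert basis `(eᵢ)`. -/
def FiniteTrace {ι H : Type*} [NormedAddCommGroup H] [InnerProductSpace ℝ H]
    (e : HilbertBasis ι ℝ H) (A : H →L[ℝ] H) : Prop :=
  Summable fun i => inner ℝ (e i) (A (e i))

/-- The trace `tr(A) = ∑ᵢ ⟨eᵢ, A eᵢ⟩`, computed in a Hilbert basis `(eᵢ)`. -/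
noncomputable def opTrace {ι H : Type*} [NormedAddCommGroup H] [InnerProductSpace ℝ H]
    (e : HilbertBasis ι ℝ H) (A : H →L[ℝ] H) : ℝ :=
  ∑' i, inner ℝ (e i) (A (e i))

/-- The constant `C₀ = 3 max(√d, 3 √(2d) (s-1))^{2s} / s!`. -/
noncomputable def scatterConst (d s : ℕ) : ℝ :=
  3 * max (Real.sqrt d) (3 * Real.sqrt (2 * d) * ((s : ℝ) - 1)) ^ (2 * s) / (s.factorial : ℝ)

/-! Put f = g - ⟨φ, Aφ⟩. Since ⟨φ, Aφ⟩ ≥ 0, a bound |f| ≤ C h^s + 2τ on Ω gives the claim there, and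
continuity extends it to the closure. As |f| ≤ τ at the samples, what is needed is a bound on the
s-th derivative of f and a sampling inequality.

Smoothness: the kernel hypothesis only provides ∂_x^α ∂_y^α in one order of differentiation. The
inner product of two iterated difference quotients of φ is a difference quotient of k, which tends
to the mixed derivative by a mean value theorem (`exists_diffQuot_eq_iterLineDeriv`). Hence the
quotients of φ are Cauchy (`exists_tendsto_diffQuot_of_kernel`); their limits are continuous partial
derivatives of φ, whose squared norms are diagonal values of mixed derivatives of k
(`contDiff_of_isDiagC`). The Leibniz rule and ‖A‖ ≤ tr A then control f
(`norm_iteratedFDeriv_sub_inner_le`).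

Sampling: let n = s - 1 ≥ 1. Each point of Ω lies in a closed ball of radius 9n²h inside the closure
of Ω. By Markov's inequality a polynomial of degree at most n is, on that ball, at most twice its
modulus at some sample in the ball (`exists_abs_le_mul_abs_of_polynomial`). Applying this to a
Taylor polynomial of f produces both h^s and 2τ (`abs_le_of_abs_le_on_samples`). For n = 0
polynomials are constant and radius h suffices. -/

open Filter Topology

/-! ### Iterated difference quotients and their mean value theorem. -/

section FiniteDifferences

variable {V F : Type*} [AddCommGroup V] [Module ℝ V]

/-- Iterated difference quotient of `f` along a list of pairs (direction, step). -/
noncomputable def diffQuot [AddCommGroup F] [Module ℝ F] :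
    List (V × ℝ) → (V → F) → V → F
  | [], f => f
  | p :: L, f => fun x => p.2⁻¹ • (diffQuot L f (x + p.2 • p.1) - diffQuot L f x)

/-- Each step travels with its direction, so only commuting difference operators are reordered.
Symmetry of mixed derivatives comes from here. -/
theorem diffQuot_perm [AddCommGroup F] [Module ℝ F] {L L' : List (V × ℝ)} (h : L.Perm L')
    (f : V → F) : diffQuot L f = diffQuot L' f := by
  induction h with
  | nil => rfl
  | cons p _ ih => simp only [diffQuot, ih]
  | swap p q L =>
    funext x
    simp only [diffQuot, add_right_comm x (p.2 • p.1) (q.2 • q.1), ← smul_sub]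
    rw [smul_comm]
    congr 2
    abel
  | trans _ _ ih₁ ih₂ => rw [ih₁, ih₂]

theorem iterLineDeriv_append (l l' : List V) (f : V → ℝ) :
    iterLineDeriv (l ++ l') f = iterLineDeriv l (iterLineDeriv l' f) := by
  induction l with
  | nil => rfl
  | cons v l ih => simp only [List.cons_append, iterLineDeriv, ih]

theorem iterLineDifferentiable_append (l l' : List V) (f : V → ℝ) :
    IterLineDifferentiable (l ++ l') f ↔
      IterLineDifferentiable l' f ∧ IterLineDifferentiable l (iterLineDeriv l' f) := by
  induction l with
  | nil => simp [IterLineDifferentiable]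
  | cons v l ih =>
    simp only [List.cons_append, IterLineDifferentiable, ih, iterLineDeriv_append, and_assoc]

theorem HasLineDerivAt.diffQuot [NormedAddCommGroup F] [NormedSpace ℝ F] {f f' : V → F} {v : V}
    (h : ∀ x, HasLineDerivAt ℝ f (f' x) x v) (L : List (V × ℝ)) (x : V) :
    HasLineDerivAt ℝ (diffQuot L f) (diffQuot L f' x) x v := by
  induction L generalizing x with
  | nil => exact h x
  | cons p L ih =>
    have h₁ := ih (x + p.2 • p.1)
    have h₂ := ih x
    unfold HasLineDerivAt at h₁ h₂ ⊢
    simp only [add_right_comm x (p.2 • p.1)] at h₁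
    exact (h₁.sub h₂).const_smul p.2⁻¹

end FiniteDifferences

theorem hasDerivAt_comp_add_smul {V F : Type*} [AddCommGroup V] [Module ℝ V]
    [NormedAddCommGroup F] [NormedSpace ℝ F] {f f' : V → F} {v : V}
    (h : ∀ x, HasLineDerivAt ℝ f (f' x) x v) (x : V) (t : ℝ) :
    HasDerivAt (fun t : ℝ => f (x + t • v)) (f' (x + t • v)) t := by
  have h₁ := h (x + t • v)
  unfold HasLineDerivAt at h₁
  have h₂ : HasDerivAt (fun u : ℝ => f (x + t • v + u • v)) (f' (x + t • v)) (t - t) := by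
    simpa using h₁
  have h₃ := h₂.comp_sub_const t t
  refine h₃.congr_of_eventuallyEq (Eventually.of_forall fun u => ?_)
  simp only [add_assoc, ← add_smul]
  congr 3
  ring

/-- Mean value theorem for iterated difference quotients. -/
theorem exists_diffQuot_eq_iterLineDeriv {V : Type*} [NormedAddCommGroup V] [NormedSpace ℝ V]
    (L : List (V × ℝ)) (f : V → ℝ) (hf : IterLineDifferentiable (L.map Prod.fst) f)
    (hL : ∀ p ∈ L, p.2 ≠ 0) (x : V) :
    ∃ y, ‖y - x‖ ≤ (L.map fun p => |p.2| * ‖p.1‖).sum ∧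
      diffQuot L f x = iterLineDeriv (L.map Prod.fst) f y := by
  induction L using List.reverseRecOn generalizing f x with
  | nil => exact ⟨x, by simp, rfl⟩
  | append_singleton L p ih =>
    rw [List.map_append, iterLineDifferentiable_append] at hf
    obtain ⟨hf₁, hf₂⟩ := hf
    set f' : V → ℝ := iterLineDeriv ([p].map Prod.fst) f
    have hd : ∀ x, HasLineDerivAt ℝ f (f' x) x p.1 := fun x => (hf₁.2 x).hasLineDerivAt
    have hp : p.2 ≠ 0 := hL p (by simp)
    -- The last direction is differentiated first, so the one-dimensional theorem is applied along
    -- `p` to the quotient along `L`, with the step rescaled to [0, 1].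
    have hd' : ∀ t : ℝ, HasDerivAt (fun t : ℝ => diffQuot L f (x + (t * p.2) • p.1))
        (diffQuot L f' (x + (t * p.2) • p.1) * p.2) t := by
      intro t
      have h₁ := hasDerivAt_comp_add_smul (HasLineDerivAt.diffQuot hd L) x (t * p.2)
      exact h₁.comp t (by simpa using (hasDerivAt_id t).mul_const p.2)
    obtain ⟨c, hc, hc'⟩ := exists_hasDerivAt_eq_slope _ _ (zero_lt_one (α := ℝ))
      (fun t _ => (hd' t).continuousAt.continuousWithinAt) (fun t _ => hd' t)
    obtain ⟨y, hy, hy'⟩ := ih f' hf₂ (fun q hq => hL q (by simp [hq])) (x + (c * p.2) • p.1)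
    refine ⟨y, ?_, ?_⟩
    · have h₁ : ‖(c * p.2) • p.1‖ ≤ |p.2| * ‖p.1‖ := by
        rw [norm_smul, norm_mul, Real.norm_eq_abs, Real.norm_eq_abs, abs_of_pos hc.1]
        have : c * |p.2| ≤ |p.2| := mul_le_of_le_one_left (abs_nonneg _) hc.2.le
        gcongr
      have h₂ : y - x = (y - (x + (c * p.2) • p.1)) + (c * p.2) • p.1 := by abel
      rw [List.map_append, List.sum_append, h₂]
      exact (norm_add_le _ _).trans (add_le_add hy (by simpa using h₁))
    · rw [List.map_append, iterLineDeriv_append, ← hy',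
        diffQuot_perm (List.perm_append_singleton p L)]
      simp only [diffQuot]
      simp only [one_mul, zero_mul, zero_smul, add_zero, sub_zero, div_one] at hc'
      rw [← hc', smul_eq_mul]
      field_simp

/-! ### Limits of difference quotients as the steps shrink. -/

section StepFilter

variable {V : Type*}

/-- Lists of (direction, step) with given directions and nonzero steps smaller than `δ`. -/
def smallSteps (l : List V) (δ : ℝ) : Set (List (V × ℝ)) :=
  {L | L.map Prod.fst = l ∧ ∀ p ∈ L, p.2 ≠ 0 ∧ |p.2| < δ}

/-- The filter of nonzero steps tending to `0` along the directions `l`. -/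
def stepFilter (l : List V) : Filter (List (V × ℝ)) :=
  ⨅ δ ∈ Set.Ioi (0 : ℝ), 𝓟 (smallSteps l δ)

theorem smallSteps_mono (l : List V) {δ δ' : ℝ} (h : δ ≤ δ') :
    smallSteps l δ ⊆ smallSteps l δ' :=
  fun _ hL => ⟨hL.1, fun p hp => ⟨(hL.2 p hp).1, (hL.2 p hp).2.trans_le h⟩⟩

theorem stepFilter_hasBasis (l : List V) :
    (stepFilter l).HasBasis (fun δ : ℝ => 0 < δ) (smallSteps l) := by
  refine hasBasis_biInf_principal ?_ ⟨1, Set.mem_Ioi.2 one_pos⟩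
  intro a ha b hb
  exact ⟨min a b, Set.mem_Ioi.2 (lt_min (Set.mem_Ioi.1 ha) (Set.mem_Ioi.1 hb)),
    smallSteps_mono l (min_le_left _ _),
    smallSteps_mono l (min_le_right _ _)⟩

instance stepFilter_neBot (l : List V) : (stepFilter l).NeBot := by
  refine (stepFilter_hasBasis l).neBot_iff.2 fun {δ} hδ => ⟨l.map fun v => (v, δ / 2), ?_, ?_⟩
  · simp [List.map_map, Function.comp_def]
  · intro p hp
    obtain ⟨v, -, rfl⟩ := List.mem_map.1 hp
    have : 0 < δ / 2 := half_pos hδ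
    exact ⟨this.ne', by rw [abs_of_pos this]; exact half_lt_self hδ⟩

theorem exists_perm_map_eq {α β : Type*} (f : α → β) {l l' : List β} (h : l.Perm l') :
    ∀ L : List α, L.map f = l → ∃ L', L.Perm L' ∧ L'.map f = l' := by
  induction h with
  | nil => exact fun L hL => ⟨L, .refl _, hL⟩
  | cons b _ ih =>
    intro L hL
    obtain ⟨a, L₁, rfl, rfl, h₁⟩ := List.map_eq_cons_iff.1 hL
    obtain ⟨L', h₂, h₃⟩ := ih L₁ h₁
    exact ⟨a :: L', h₂.cons a, by simp [h₃]⟩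
  | swap b c l =>
    intro L hL
    obtain ⟨a, L₁, rfl, rfl, h₁⟩ := List.map_eq_cons_iff.1 hL
    obtain ⟨a', L₂, rfl, rfl, rfl⟩ := List.map_eq_cons_iff.1 h₁
    exact ⟨a' :: a :: L₂, .swap _ _ _, rfl⟩
  | trans _ _ ih₁ ih₂ =>
    intro L hL
    obtain ⟨L₁, h₁, h₂⟩ := ih₁ L hL
    obtain ⟨L₂, h₃, h₄⟩ := ih₂ L₁ h₂
    exact ⟨L₂, h₁.trans h₃, h₄⟩

theorem exists_perm_mem_smallSteps {l l' : List V} (h : l.Perm l') {δ : ℝ}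
    {L : List (V × ℝ)} (hL : L ∈ smallSteps l δ) : ∃ L' ∈ smallSteps l' δ, L.Perm L' := by
  obtain ⟨L', h₁, h₂⟩ := exists_perm_map_eq Prod.fst h L hL.1
  exact ⟨L', ⟨h₂, fun p hp => hL.2 p (h₁.mem_iff.2 hp)⟩, h₁⟩

theorem tendsto_diffQuot_perm {F : Type*} [AddCommGroup V] [Module ℝ V] [NormedAddCommGroup F]
    [NormedSpace ℝ F] {l l' : List V} (h : l.Perm l') {f : V → F} {x : V} {z : F}
    (hz : Tendsto (fun L => diffQuot L f x) (stepFilter l) (𝓝 z)) :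
    Tendsto (fun L => diffQuot L f x) (stepFilter l') (𝓝 z) := by
  intro s hs
  obtain ⟨δ, hδ, h₁⟩ := (stepFilter_hasBasis l).mem_iff.1 (hz hs)
  refine (stepFilter_hasBasis l').mem_iff.2 ⟨δ, hδ, fun L hL => ?_⟩
  obtain ⟨L', h₂, h₃⟩ := exists_perm_mem_smallSteps h.symm hL
  have := h₁ h₂
  rwa [Set.mem_preimage, ← diffQuot_perm h₃] at this

theorem tendsto_stepFilter_prod {W : Type*} (l : List V) (l' : List W) (o : V) (o' : W) :
    Tendsto (fun P : List (V × ℝ) × List (W × ℝ) =>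
        P.1.map (fun p => ((p.1, o'), p.2)) ++ P.2.map (fun p => ((o, p.1), p.2)))
      (stepFilter l ×ˢ stepFilter l')
      (stepFilter (l.map (fun v => (v, o')) ++ l'.map (fun w => (o, w)))) := by
  refine ((stepFilter_hasBasis l).prod (stepFilter_hasBasis l')).tendsto_iff
    (stepFilter_hasBasis _) |>.2 fun δ hδ => ⟨(δ, δ), ⟨hδ, hδ⟩, ?_⟩
  rintro ⟨L, L'⟩ ⟨⟨rfl, h₁⟩, ⟨rfl, h₂⟩⟩
  refine ⟨by simp [Function.comp_def], fun p hp => ?_⟩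
  rcases List.mem_append.1 hp with hp | hp
  · obtain ⟨q, hq, rfl⟩ := List.mem_map.1 hp
    exact h₁ q hq
  · obtain ⟨q, hq, rfl⟩ := List.mem_map.1 hp
    exact h₂ q hq

/-- The mean value point tends to `x` with the steps, so continuity of the top derivative alone
suffices. -/
theorem tendsto_diffQuot_iterLineDeriv [NormedAddCommGroup V] [NormedSpace ℝ V] {l : List V}
    {f : V → ℝ} (hf : IterLineDifferentiable l f) (hc : Continuous (iterLineDeriv l f)) (x : V) :
    Tendsto (fun L => diffQuot L f x) (stepFilter l) (𝓝 (iterLineDeriv l f x)) := by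
  intro s hs
  obtain ⟨ε, hε, h₁⟩ := Metric.mem_nhds_iff.1 (hc.continuousAt.preimage_mem_nhds hs)
  set N : ℝ := (l.map fun v => ‖v‖).sum
  have hN : 0 ≤ N := List.sum_nonneg (by simp)
  refine (stepFilter_hasBasis l).mem_iff.2 ⟨ε / (N + 1), by positivity, ?_⟩
  rintro L ⟨rfl, hL⟩
  obtain ⟨y, hy, hy'⟩ := exists_diffQuot_eq_iterLineDeriv L f hf (fun p hp => (hL p hp).1) x
  rw [Set.mem_preimage, hy']
  refine h₁ ?_
  rw [Metric.mem_ball, dist_eq_norm]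
  have h₂ : (L.map fun p => |p.2| * ‖p.1‖).sum ≤ ε / (N + 1) * N := by
    have hN' : N = (L.map fun p => ‖p.1‖).sum := by
      simp only [N, List.map_map, Function.comp_def]
    calc (L.map fun p => |p.2| * ‖p.1‖).sum ≤ (L.map fun p => ε / (N + 1) * ‖p.1‖).sum :=
          List.sum_le_sum fun p hp => mul_le_mul_of_nonneg_right (hL p hp).2.le (norm_nonneg _)
      _ = ε / (N + 1) * N := by rw [List.sum_map_mul_left, hN']
  refine (hy.trans h₂).trans_lt ?_
  rw [div_mul_eq_mul_div, div_lt_iff₀ (by positivity)]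
  nlinarith

/-- Mixed iterated derivatives of a real function do not depend on the order of the directions. -/
theorem iterLineDeriv_perm [NormedAddCommGroup V] [NormedSpace ℝ V] {l l' : List V}
    (h : l.Perm l') {f : V → ℝ} (hf : IterLineDifferentiable l f)
    (hc : Continuous (iterLineDeriv l f)) (hf' : IterLineDifferentiable l' f)
    (hc' : Continuous (iterLineDeriv l' f)) : iterLineDeriv l f = iterLineDeriv l' f :=
  funext fun x => tendsto_nhds_unique
    (tendsto_diffQuot_perm h (tendsto_diffQuot_iterLineDeriv hf hc x))
    (tendsto_diffQuot_iterLineDeriv hf' hc' x)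

/-- The limit of the iterated difference quotients along the directions `l`. -/
noncomputable def limDeriv {F : Type*} [AddCommGroup V] [Module ℝ V] [NormedAddCommGroup F]
    [NormedSpace ℝ F] (l : List V) (f : V → F) (x : V) : F :=
  limUnder (stepFilter l) fun L => diffQuot L f x

theorem limDeriv_nil {F : Type*} [AddCommGroup V] [Module ℝ V] [NormedAddCommGroup F]
    [NormedSpace ℝ F] (f : V → F) : limDeriv [] f = f := by
  funext x
  refine Tendsto.limUnder_eq (tendsto_const_nhds.congr' ?_)
  refine (stepFilter_hasBasis ([] : List V)).eventually_iff.2 ⟨1, one_pos, fun L hL => ?_⟩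
  rw [List.map_eq_nil_iff.1 hL.1]
  rfl

/-- A joint limit controls the iterated one: fix the step `t` along `v`, let the steps along `l`
tend to 0, and remain in a closed neighbourhood. -/
theorem hasLineDerivAt_limDeriv {F : Type*} [AddCommGroup V] [Module ℝ V] [NormedAddCommGroup F]
    [NormedSpace ℝ F] {l : List V} {v : V} {f : V → F}
    (h : ∀ x, ∃ z, Tendsto (fun L => diffQuot L f x) (stepFilter l) (𝓝 z)) {x : V}
    (h' : ∃ z, Tendsto (fun L => diffQuot L f x) (stepFilter (v :: l)) (𝓝 z)) :
    HasLineDerivAt ℝ (limDeriv l f) (limDeriv (v :: l) f x) x v := by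
  rw [hasLineDerivAt_iff_tendsto_slope_zero]
  have h₁ := tendsto_nhds_limUnder h'
  have h₀ := fun x => tendsto_nhds_limUnder (h x)
  refine (closed_nhds_basis _).ge_iff.2 fun C hC => ?_
  obtain ⟨δ, hδ, h₂⟩ := (stepFilter_hasBasis _).mem_iff.1 (h₁ hC.1)
  have h₃ : ∀ᶠ t : ℝ in 𝓝[≠] 0, |t| < δ ∧ t ≠ 0 := by
    refine (eventually_nhdsWithin_of_eventually_nhds ?_).and eventually_mem_nhdsWithin
    filter_upwards [Metric.ball_mem_nhds (0 : ℝ) hδ] with t ht using by simpa using ht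
  change ∀ᶠ t : ℝ in 𝓝[≠] 0, t⁻¹ • (limDeriv l f (x + t • v) - limDeriv l f x) ∈ C
  filter_upwards [h₃] with t ht
  refine hC.2.mem_of_tendsto (((h₀ (x + t • v)).sub (h₀ x)).const_smul t⁻¹) ?_
  refine (stepFilter_hasBasis l).eventually_iff.2 ⟨δ, hδ, fun L hL => ?_⟩
  refine @h₂ ((v, t) :: L) ⟨by simp [hL.1], fun p hp => ?_⟩
  rcases List.mem_cons.1 hp with rfl | hp
  · exact ⟨ht.2, ht.1⟩
  · exact hL.2 p hp

end StepFilter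

/-! ### Differentiating a feature map through its kernel. -/

section Hilbert

variable {V H : Type*} [NormedAddCommGroup H] [InnerProductSpace ℝ H]

/-- Cauchy criterion: expanding ‖a i - a j‖² gives the limit c - 2c + c = 0. -/
theorem exists_tendsto_of_tendsto_inner [CompleteSpace H] {ι : Type*} {l : Filter ι} [l.NeBot]
    {a : ι → H} {c : ℝ}
    (h : Tendsto (fun p : ι × ι => inner ℝ (a p.1) (a p.2)) (l ×ˢ l) (𝓝 c)) :
    ∃ z, Tendsto a l (𝓝 z) := by
  refine cauchy_map_iff_exists_tendsto.1 (cauchy_map_iff.2 ⟨inferInstance, ?_⟩)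
  rw [tendsto_uniformity_iff_dist_tendsto_zero]
  have h₀ : Tendsto (fun i => inner ℝ (a i) (a i)) l (𝓝 c) :=
    h.comp (tendsto_id.prodMk tendsto_id)
  have h₁ : Tendsto (fun p : ι × ι => dist (a p.1) (a p.2) ^ 2) (l ×ˢ l) (𝓝 (c - 2 * c + c)) := by
    refine (((h₀.comp tendsto_fst).sub (h.const_mul 2)).add (h₀.comp tendsto_snd)).congr
      fun p => ?_
    simp only [Function.comp_apply, dist_eq_norm, norm_sub_sq_real, real_inner_self_eq_norm_sq]
  have h₂ := (Real.continuous_sqrt.tendsto _).comp h₁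
  have h₃ : c - 2 * c + c = 0 := by ring
  rw [h₃, Real.sqrt_zero] at h₂
  exact h₂.congr fun p => by simp [Real.sqrt_sq dist_nonneg]

theorem continuous_of_continuous_inner {X : Type*} [TopologicalSpace X] {f : X → H}
    (h : Continuous fun p : X × X => inner ℝ (f p.1) (f p.2)) : Continuous f := by
  rw [continuous_iff_continuousAt]
  intro x
  rw [ContinuousAt, tendsto_iff_dist_tendsto_zero]
  have h₁ : Continuous fun y => √(inner ℝ (f y) (f y) - 2 * inner ℝ (f y) (f x)
      + inner ℝ (f x) (f x)) := by
    have h₂ : Continuous fun y => inner ℝ (f y) (f y) :=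
      h.comp (by fun_prop : Continuous fun y => (y, y))
    have h₃ : Continuous fun y => inner ℝ (f y) (f x) :=
      h.comp (by fun_prop : Continuous fun y => (y, x))
    fun_prop
  have h₂ := h₁.tendsto x
  have h₃ : inner ℝ (f x) (f x) - 2 * inner ℝ (f x) (f x) + inner ℝ (f x) (f x) = (0 : ℝ) := by ring
  simp only [h₃, Real.sqrt_zero] at h₂
  refine h₂.congr fun y => ?_
  rw [dist_eq_norm, real_inner_self_eq_norm_sq, real_inner_self_eq_norm_sq, ← norm_sub_sq_real,
    Real.sqrt_sq (norm_nonneg _)]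

variable [AddCommGroup V] [Module ℝ V]

theorem inner_diffQuot_diffQuot (φ : V → H) (L L' : List (V × ℝ)) (x y : V) :
    inner ℝ (diffQuot L φ x) (diffQuot L' φ y) =
      diffQuot (L.map (fun p => ((p.1, (0 : V)), p.2)) ++ L'.map (fun p => (((0 : V), p.1), p.2)))
        (fun p : V × V => inner ℝ (φ p.1) (φ p.2)) (x, y) := by
  induction L generalizing x with
  | nil =>
    induction L' generalizing y with
    | nil => rfl
    | cons p L' ih =>
      simp only [List.map_nil, List.nil_append] at ih
      simp only [diffQuot, List.map_nil, List.nil_append, List.map_cons, Prod.smul_mk, smul_zero,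
        Prod.mk_add_mk, add_zero, ← ih, inner_smul_right, inner_sub_right, smul_eq_mul]
  | cons p L ih =>
    simp only [diffQuot, List.map_cons, List.cons_append, Prod.smul_mk, smul_zero,
        Prod.mk_add_mk, add_zero, ← ih, real_inner_smul_left, inner_sub_left, smul_eq_mul]

/-- If the kernel `⟨φ(x), φ(y)⟩` has continuous derivatives along `l` in both variables, then the
feature map `φ` is differentiable along `l`, in the norm of the Hilbert space. -/
theorem exists_tendsto_diffQuot_of_kernel {V : Type*} [NormedAddCommGroup V] [NormedSpace ℝ V]
    [CompleteSpace H] {φ : V → H} {l l' : List V} (hl : l'.Perm l)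
    (hd : IterLineDifferentiable (l'.map (fun v => (v, (0 : V))) ++ l'.map (fun v => ((0 : V), v)))
      fun p : V × V => inner ℝ (φ p.1) (φ p.2))
    (hc : Continuous (iterLineDeriv
      (l'.map (fun v => (v, (0 : V))) ++ l'.map (fun v => ((0 : V), v)))
      fun p : V × V => inner ℝ (φ p.1) (φ p.2))) :
    (∀ x, ∃ z, Tendsto (fun L => diffQuot L φ x) (stepFilter l) (𝓝 z)) ∧
      ∀ x y, inner ℝ (limDeriv l φ x) (limDeriv l φ y) =
        iterLineDeriv (l'.map (fun v => (v, (0 : V))) ++ l'.map (fun v => ((0 : V), v)))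
          (fun p : V × V => inner ℝ (φ p.1) (φ p.2)) (x, y) := by
  have h₁ : ∀ x y, Tendsto (fun P : List (V × ℝ) × List (V × ℝ) =>
      inner ℝ (diffQuot P.1 φ x) (diffQuot P.2 φ y)) (stepFilter l ×ˢ stepFilter l)
      (𝓝 (iterLineDeriv (l'.map (fun v => (v, (0 : V))) ++ l'.map (fun v => ((0 : V), v)))
          (fun p : V × V => inner ℝ (φ p.1) (φ p.2)) (x, y))) := by
    intro x y
    have h₂ := tendsto_diffQuot_iterLineDeriv hd hc (x, y)
    have h₃ := tendsto_diffQuot_perm ((hl.map _).append (hl.map _)) h₂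
    exact (h₃.comp (tendsto_stepFilter_prod l l 0 0)).congr
      fun P => (inner_diffQuot_diffQuot φ P.1 P.2 x y).symm
  have h₂ : ∀ x, ∃ z, Tendsto (fun L => diffQuot L φ x) (stepFilter l) (𝓝 z) :=
    fun x => exists_tendsto_of_tendsto_inner (h₁ x x)
  refine ⟨h₂, fun x y => tendsto_nhds_unique ?_ (h₁ x y)⟩
  exact ((tendsto_nhds_limUnder (h₂ x)).comp tendsto_fst).inner
    ((tendsto_nhds_limUnder (h₂ y)).comp tendsto_snd)

end Hilbert

/-! ### Continuous partial derivatives imply C^n. -/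

section ContinuousPartials

variable {d : ℕ} {F : Type*} [NormedAddCommGroup F] [NormedSpace ℝ F]

theorem norm_sum_smul_single_le (v : Rd d) (T : Finset (Fin d)) :
    ‖∑ i ∈ T, v i • (EuclideanSpace.single i (1 : ℝ) : Rd d)‖ ≤ ∑ i ∈ T, |v i| :=
  (norm_sum_le _ _).trans (Finset.sum_le_sum fun i _ => by simp [norm_smul])

theorem sum_smul_single (v : Rd d) :
    ∑ i, v i • (EuclideanSpace.single i (1 : ℝ) : Rd d) = v := by
  simpa using (EuclideanSpace.basisFun (Fin d) ℝ).sum_repr v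

/-- Coordinates change one at a time; along each edge the mean value inequality is applied to `f`
minus its linear part at `x`. -/
theorem norm_telescope_le {f : Rd d → F} {f' : Fin d → Rd d → F}
    (h : ∀ i x, HasLineDerivAt ℝ f (f' i x) x (EuclideanSpace.single i (1 : ℝ)))
    {x : Rd d} {ε δ : ℝ} (hδ : ∀ i z, ‖z - x‖ < δ → ‖f' i z - f' i x‖ ≤ ε)
    {v : Rd d} (T : Finset (Fin d)) (hv : ∑ i ∈ T, |v i| < δ) :
    ‖f (x + ∑ i ∈ T, v i • (EuclideanSpace.single i (1 : ℝ) : Rd d)) - f x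
      - ∑ i ∈ T, v i • f' i x‖ ≤ ε * ∑ i ∈ T, |v i| := by
  induction T using Finset.induction_on with
  | empty => simp
  | insert a T ha ih =>
    rw [Finset.sum_insert ha] at hv
    have hv' : ∑ i ∈ T, |v i| < δ := lt_of_le_of_lt (by linarith [abs_nonneg (v a)]) hv
    have ih := ih hv'
    set p : Rd d := x + ∑ i ∈ T, v i • (EuclideanSpace.single i (1 : ℝ) : Rd d)
    set e : Rd d := EuclideanSpace.single a (1 : ℝ)
    have h₁ : ∀ t ∈ Set.uIcc 0 (v a), HasDerivWithinAt (fun t : ℝ => f (p + t • e) - t • f' a x)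
        (f' a (p + t • e) - f' a x) (Set.uIcc 0 (v a)) t := by
      intro t _
      have := (hasDerivAt_comp_add_smul (h a) p t).sub ((hasDerivAt_id t).smul_const (f' a x))
      rw [one_smul] at this
      exact this.hasDerivWithinAt
    have h₂ : ∀ t ∈ Set.uIcc 0 (v a), ‖f' a (p + t • e) - f' a x‖ ≤ ε := by
      intro t ht
      refine hδ a _ ?_
      have h₃ : |t| ≤ |v a| := by
        have := Set.abs_sub_left_of_mem_uIcc ht
        simpa using this
      have h₄ : p + t • e - x =
          (∑ i ∈ T, v i • (EuclideanSpace.single i (1 : ℝ) : Rd d)) + t • e := by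
        simp only [p]; abel
      have h₅ : ‖t • e‖ = |t| := by simp [e, norm_smul]
      rw [h₄]
      have := norm_add_le (∑ i ∈ T, v i • (EuclideanSpace.single i (1 : ℝ) : Rd d)) (t • e)
      linarith [norm_sum_smul_single_le v T]
    have h₃ := Convex.norm_image_sub_le_of_norm_hasDerivWithin_le h₁ h₂ (convex_uIcc _ _)
      Set.left_mem_uIcc Set.right_mem_uIcc
    rw [Finset.sum_insert ha, Finset.sum_insert ha, Finset.sum_insert ha]
    have h₄ : f (x + (v a • e + ∑ i ∈ T, v i • (EuclideanSpace.single i (1 : ℝ) : Rd d))) - f x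
        - (v a • f' a x + ∑ i ∈ T, v i • f' i x) =
        ((f (p + v a • e) - v a • f' a x) - (f (p + (0 : ℝ) • e) - (0 : ℝ) • f' a x))
          + (f p - f x - ∑ i ∈ T, v i • f' i x) := by
      have : x + (v a • e + ∑ i ∈ T, v i • (EuclideanSpace.single i (1 : ℝ) : Rd d))
          = p + v a • e := by simp only [p]; abel
      rw [this]
      simp only [zero_smul, add_zero, sub_zero]
      abel
    rw [h₄]
    refine (norm_add_le _ _).trans ?_
    have h₅ : ‖v a - 0‖ = |v a| := by simp
    rw [h₅] at h₃
    rw [mul_add]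
    exact add_le_add h₃ ih

/-- A function with continuous partial derivatives is differentiable. -/
theorem hasFDerivAt_of_hasLineDerivAt_single {f : Rd d → F} {f' : Fin d → Rd d → F}
    (h : ∀ i x, HasLineDerivAt ℝ f (f' i x) x (EuclideanSpace.single i (1 : ℝ)))
    (hc : ∀ i, Continuous (f' i)) (x : Rd d) :
    HasFDerivAt f (∑ i, (EuclideanSpace.proj i : Rd d →L[ℝ] ℝ).smulRight (f' i x)) x := by
  rw [hasFDerivAt_iff_isLittleO_nhds_zero, Asymptotics.isLittleO_iff]
  intro c hc₀
  have hε : 0 < c / (d + 1) := by positivity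
  have h₁ : ∀ᶠ z in 𝓝 x, ∀ i, ‖f' i z - f' i x‖ < c / (d + 1) := by
    rw [eventually_all]
    intro i
    have := (hc i).continuousAt.eventually (Metric.ball_mem_nhds (f' i x) hε)
    filter_upwards [this] with z hz using by simpa [dist_eq_norm] using hz
  obtain ⟨δ, hδ, h₂⟩ := Metric.eventually_nhds_iff.1 h₁
  have hδ' : 0 < δ / (d + 1) := by positivity
  filter_upwards [Metric.ball_mem_nhds (0 : Rd d) hδ'] with v hv
  rw [mem_ball_zero_iff, lt_div_iff₀ (by positivity)] at hv
  have h₃ : ∑ i, |v i| ≤ ‖v‖ * d := by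
    calc ∑ i, |v i| ≤ ∑ _i : Fin d, ‖v‖ :=
          Finset.sum_le_sum fun i _ => PiLp.norm_apply_le v i
      _ = ‖v‖ * d := by simp [mul_comm]
  have h₄ := norm_telescope_le h (x := x) (ε := c / (d + 1)) (δ := δ)
    (fun i z hz => (h₂ (by rwa [dist_eq_norm]) i).le) (v := v) Finset.univ
    (by nlinarith [norm_nonneg v])
  rw [sum_smul_single] at h₄
  have h₅ : (∑ i, (EuclideanSpace.proj i : Rd d →L[ℝ] ℝ).smulRight (f' i x)) v =
      ∑ i, v i • f' i x := by simp
  rw [h₅]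
  refine h₄.trans ?_
  calc c / (d + 1) * ∑ i, |v i| ≤ c / (d + 1) * (‖v‖ * (d + 1)) := by
        gcongr
        nlinarith [norm_nonneg v]
    _ = c * ‖v‖ := by field_simp

/-- Indexing all candidate derivatives by lists keeps the induction within one family: the
derivative of `ψ l` is assembled from the `ψ (i :: l)`. -/
theorem contDiff_of_hasLineDerivAt_single {n : ℕ} {ψ : List (Fin d) → Rd d → F}
    (h : ∀ i l, l.length < n → ∀ x,
      HasLineDerivAt ℝ (ψ l) (ψ (i :: l) x) x (EuclideanSpace.single i (1 : ℝ)))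
    (hc : ∀ l, l.length ≤ n → Continuous (ψ l)) (k : ℕ) (l : List (Fin d))
    (hl : l.length + k ≤ n) : ContDiff ℝ k (ψ l) := by
  induction k generalizing l with
  | zero => exact contDiff_zero.2 (hc l hl)
  | succ k ih =>
    have h₁ := fun x => hasFDerivAt_of_hasLineDerivAt_single (f := ψ l)
      (f' := fun i => ψ (i :: l)) (fun i x => h i l (by omega) x)
      (fun i => hc _ (by simp only [List.length_cons]; omega)) x
    have h₂ := funext fun x => (h₁ x).fderiv
    push_cast
    rw [contDiff_succ_iff_fderiv]
    refine ⟨fun x => (h₁ x).differentiableAt, fun h => by simp at h, ?_⟩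
    rw [h₂]
    refine ContDiff.sum fun i _ => ?_
    exact contDiff_const.smulRight (ih (i :: l) (by simp only [List.length_cons]; omega))

end ContinuousPartials

/-! ### Fréchet derivatives versus iterated line derivatives. -/

section IteratedDerivatives

variable {V F : Type*} [NormedAddCommGroup V] [NormedSpace ℝ V] [NormedAddCommGroup F]
  [NormedSpace ℝ F]

theorem iteratedFDeriv_apply_eq_of_lineDeriv {β : Type*} (e : β → V) {N : ℕ} {f : V → F}
    (hf : ContDiff ℝ N f) {G : List β → V → F} (h₀ : G [] = f)
    (h : ∀ b l, l.length < N → ∀ x, G (b :: l) x = lineDeriv ℝ (G l) x (e b))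
    (n : ℕ) (hn : n ≤ N) (i : Fin n → β) (x : V) :
    iteratedFDeriv ℝ n f x (fun j => e (i j)) = G (List.ofFn i) x := by
  induction n generalizing x with
  | zero => simp [h₀]
  | succ n ih =>
    have hD : DifferentiableAt ℝ (iteratedFDeriv ℝ n f) x :=
      hf.differentiable_iteratedFDeriv (by exact_mod_cast hn) x
    have h₁ : G (List.ofFn fun j : Fin n => i j.succ) =
        fun x => iteratedFDeriv ℝ n f x (fun j => e (i j.succ)) :=
      funext fun y => (ih (by omega) _ y).symm
    rw [List.ofFn_succ, h _ _ (by simpa using hn), h₁, iteratedFDeriv_succ_apply_left]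
    rw [((hD.hasFDerivAt.continuousMultilinear_apply_const _).hasLineDerivAt _).lineDeriv]
    rfl

theorem ContDiff.iterLineDeriv {f : V → ℝ} (l : List V) (n : ℕ)
    (hf : ContDiff ℝ (n + l.length : ℕ) f) : ContDiff ℝ n (iterLineDeriv l f) := by
  induction l generalizing n with
  | nil => exact hf
  | cons v l ih =>
    have h₁ := ih (n + 1) (by convert hf using 2; simp; ring)
    have h₂ : _root_.iterLineDeriv (v :: l) f =
        fun x => fderiv ℝ (_root_.iterLineDeriv l f) x v :=
      funext fun x => ((h₁.differentiable (by simp)) x).lineDeriv_eq_fderiv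
    rw [h₂]
    exact (h₁.fderiv_right (m := n) (by push_cast; rfl)).clm_apply contDiff_const

theorem ContDiff.iterLineDifferentiable {f : V → ℝ} (l : List V)
    (hf : ContDiff ℝ l.length f) : IterLineDifferentiable l f := by
  induction l with
  | nil => trivial
  | cons v l ih =>
    refine ⟨ih (hf.of_le (by simp)), fun x => ?_⟩
    have h₁ : ContDiff ℝ 1 (_root_.iterLineDeriv l f) :=
      ContDiff.iterLineDeriv l 1 (by convert hf using 2; simp; ring)
    exact ((h₁.differentiable (by simp)) x).lineDifferentiableAt

theorem iteratedFDeriv_apply_eq_iterLineDeriv {n : ℕ} {f : V → ℝ} (hf : ContDiff ℝ n f)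
    (v : Fin n → V) (x : V) : iteratedFDeriv ℝ n f x v = iterLineDeriv (List.ofFn v) f x :=
  iteratedFDeriv_apply_eq_of_lineDeriv id hf (G := fun l => iterLineDeriv l f) rfl
    (fun _ _ _ _ => rfl) n le_rfl v x

end IteratedDerivatives

/-! ### Multi-indices and norms of multilinear maps. -/

section MultiIndex

variable {d : ℕ}

theorem perm_flatMap_replicate_count (l : List (Fin d)) :
    l.Perm ((List.finRange d).flatMap fun i => List.replicate (l.count i) i) := by
  rw [List.perm_iff_count]
  intro a
  rw [List.count_flatMap, ← Fin.sum_univ_def]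
  simp [List.count_replicate]

theorem map_single_perm_multiDirs (l : List (Fin d)) :
    (l.map fun i => (EuclideanSpace.single i (1 : ℝ) : Rd d)).Perm
      (multiDirs fun i => l.count i) := by
  refine ((perm_flatMap_replicate_count l).map _).trans ?_
  rw [multiDirs, List.map_flatMap]
  simp

theorem sum_count_eq_length (l : List (Fin d)) : ∑ i, l.count i = l.length := by
  conv_rhs => rw [(perm_flatMap_replicate_count l).length_eq]
  rw [List.length_flatMap, Fin.sum_univ_def]
  simp

/-- The values of the `n`-th derivative on basis vectors are partial derivatives. -/
theorem exists_iteratedFDeriv_single_eq_partialDeriv {n : ℕ} {g : Rd d → ℝ}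
    (hg : ContDiff ℝ n g) (i : Fin n → Fin d) :
    ∃ α : Fin d → ℕ, ∑ i, α i = n ∧ ∀ x,
      iteratedFDeriv ℝ n g x (fun j => EuclideanSpace.single (i j) (1 : ℝ)) =
        partialDeriv α g x := by
  refine ⟨fun a => (List.ofFn i).count a, by rw [sum_count_eq_length]; simp, fun x => ?_⟩
  rw [iteratedFDeriv_apply_eq_iterLineDeriv hg]
  have h₁ := map_single_perm_multiDirs (List.ofFn i)
  rw [List.map_ofFn] at h₁
  have h₂ := h₁.length_eq
  rw [List.length_ofFn] at h₂
  refine congrFun (iterLineDeriv_perm h₁ ?_ ?_ ?_ ?_) x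
  · exact ContDiff.iterLineDifferentiable _ (by simpa using hg)
  · exact (ContDiff.iterLineDeriv _ 0 (by simpa using hg)).continuous
  · exact ContDiff.iterLineDifferentiable _ (by rwa [← h₂])
  · exact (ContDiff.iterLineDeriv _ 0 (by rwa [← h₂, zero_add])).continuous

theorem continuous_partialDeriv {n : ℕ} {g : Rd d → ℝ} (hg : ContDiff ℝ n g) {α : Fin d → ℕ}
    (hα : ∑ i, α i = n) : Continuous (partialDeriv α g) := by
  refine (ContDiff.iterLineDeriv _ 0 ?_).continuous
  have : (multiDirs α).length = n := by
    rw [multiDirs, List.length_flatMap, ← hα, Fin.sum_univ_def]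
    simp
  rwa [this, zero_add]

theorem sum_abs_le_sqrt_mul_norm (v : Rd d) : ∑ i, |v i| ≤ √d * ‖v‖ := by
  rw [EuclideanSpace.norm_eq, ← Real.sqrt_mul (Nat.cast_nonneg d)]
  refine Real.le_sqrt_of_sq_le ?_
  simpa using sq_sum_le_card_mul_sum_sq (s := Finset.univ) (f := fun i => |v i|)

/-- Expanded in the standard basis, the sum over index tuples factors into ℓ¹ norms, each at most √d
times the Euclidean norm. -/
theorem ContinuousMultilinearMap.norm_le_of_single {n : ℕ} {F : Type*} [NormedAddCommGroup F]
    [NormedSpace ℝ F] (m : ContinuousMultilinearMap ℝ (fun _ : Fin n => Rd d) F) {B : ℝ}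
    (hB₀ : 0 ≤ B)
    (hB : ∀ i : Fin n → Fin d, ‖m fun j => EuclideanSpace.single (i j) (1 : ℝ)‖ ≤ B) :
    ‖m‖ ≤ √d ^ n * B := by
  refine ContinuousMultilinearMap.opNorm_le_bound (by positivity) fun v => ?_
  have h₁ : m v = ∑ i : Fin n → Fin d, (∏ j, v j (i j)) •
      m fun j => EuclideanSpace.single (i j) (1 : ℝ) := by
    conv_lhs => rw [show v = fun j => ∑ a, v j a • (EuclideanSpace.single a (1 : ℝ) : Rd d) from
      funext fun j => (sum_smul_single (v j)).symm]
    rw [m.map_sum]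
    exact Finset.sum_congr rfl fun i _ => m.map_smul_univ _ _
  calc ‖m v‖ ≤ ∑ i : Fin n → Fin d, (∏ j, |v j (i j)|) * B := by
        rw [h₁]
        refine (norm_sum_le _ _).trans (Finset.sum_le_sum fun i _ => ?_)
        rw [norm_smul, Real.norm_eq_abs, Finset.abs_prod]
        exact mul_le_mul_of_nonneg_left (hB i) (Finset.prod_nonneg fun _ _ => abs_nonneg _)
    _ = (∏ j, ∑ a, |v j a|) * B := by
        rw [Finset.prod_univ_sum, Finset.sum_mul, Fintype.piFinset_univ]
    _ ≤ (∏ j, √d * ‖v j‖) * B := by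
        refine mul_le_mul_of_nonneg_right (Finset.prod_le_prod (fun j _ => ?_) fun j _ => ?_) hB₀
        · exact Finset.sum_nonneg fun _ _ => abs_nonneg _
        · exact sum_abs_le_sqrt_mul_norm (v j)
    _ = √d ^ n * B * ∏ j, ‖v j‖ := by
        rw [Finset.prod_mul_distrib]
        simp
        ring

end MultiIndex

/-! ### Feature maps of C^{s,s} kernels. -/

section Kernel

variable {d : ℕ} {H : Type*} [NormedAddCommGroup H] [InnerProductSpace ℝ H] [CompleteSpace H]

/-- If the kernel of a feature map is of class `C^{s,s}`, the feature map is of class `C^s`. -/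
theorem contDiff_of_isDiagC {s : ℕ} {φ : Rd d → H}
    (hk : IsDiagC s fun x y => inner ℝ (φ x) (φ y)) :
    ContDiff ℝ s φ ∧ ∀ n ≤ s, ∀ i : Fin n → Fin d, ∃ α : Fin d → ℕ, ∑ i, α i ≤ s ∧ ∀ x,
      ‖iteratedFDeriv ℝ n φ x (fun j => EuclideanSpace.single (i j) (1 : ℝ))‖ ^ 2 =
        diagDeriv α (fun x y => inner ℝ (φ x) (φ y)) (x, x) := by
  set ψ : List (Fin d) → Rd d → H := fun l =>
    limDeriv (l.map fun i => (EuclideanSpace.single i (1 : ℝ) : Rd d)) φ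
  have h₁ : ∀ l : List (Fin d), l.length ≤ s → (∀ x, ∃ z, Tendsto (fun L => diffQuot L φ x)
      (stepFilter (l.map fun i => (EuclideanSpace.single i (1 : ℝ) : Rd d))) (𝓝 z)) ∧
      ∀ x y, inner ℝ (ψ l x) (ψ l y) =
        diagDeriv (fun i => l.count i) (fun x y => inner ℝ (φ x) (φ y)) (x, y) := by
    intro l hl
    obtain ⟨h₂, h₃⟩ := hk (fun i => l.count i) (by rwa [sum_count_eq_length])
    exact exists_tendsto_diffQuot_of_kernel (map_single_perm_multiDirs l).symm h₂ h₃
  have hline : ∀ i l, l.length < s → ∀ x,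
      HasLineDerivAt ℝ (ψ l) (ψ (i :: l) x) x (EuclideanSpace.single i (1 : ℝ)) :=
    fun i l hl x => hasLineDerivAt_limDeriv (h₁ l hl.le).1 ((h₁ (i :: l) hl).1 x)
  have hcont : ∀ l, l.length ≤ s → Continuous (ψ l) := by
    intro l hl
    refine continuous_of_continuous_inner ?_
    simp only [(h₁ l hl).2]
    exact (hk (fun i => l.count i) (by rwa [sum_count_eq_length])).2
  have h₀ : ψ [] = φ := limDeriv_nil φ
  have hφ : ContDiff ℝ s φ := by
    have := contDiff_of_hasLineDerivAt_single hline hcont s [] (by simp)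
    rwa [h₀] at this
  refine ⟨hφ, fun n hn i => ⟨fun a => (List.ofFn i).count a, ?_, fun x => ?_⟩⟩
  · rw [sum_count_eq_length]
    simpa using hn
  · have h₂ := iteratedFDeriv_apply_eq_of_lineDeriv
      (fun i => (EuclideanSpace.single i (1 : ℝ) : Rd d)) hφ (G := ψ) h₀
      (fun i l hl x => (hline i l hl x).lineDeriv.symm) n hn i x
    rw [h₂, ← real_inner_self_eq_norm_sq]
    exact (h₁ _ (by simpa using hn)).2 x x

end Kernel

/-! ### Positive operators, trace and the Leibniz bound. -/

section Trace

variable {ι H : Type*} [NormedAddCommGroup H] [InnerProductSpace ℝ H]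

theorem ContinuousLinearMap.IsPositive.inner_sq_le {A : H →L[ℝ] H} (hA : A.IsPositive) (u v : H) :
    inner ℝ u (A v) ^ 2 ≤ inner ℝ u (A u) * inner ℝ v (A v) := by
  set B : LinearMap.BilinForm ℝ H := LinearMap.mk₂ ℝ (fun u v => inner ℝ u (A v))
    (fun _ _ _ => inner_add_left _ _ _) (fun _ _ _ => real_inner_smul_left _ _ _)
    (fun _ _ _ => by rw [map_add, inner_add_right])
    (fun _ _ _ => by rw [map_smul, real_inner_smul_right]; rfl)
  have h := LinearMap.BilinForm.apply_mul_apply_le_of_forall_zero_le B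
    (fun x => hA.inner_nonneg_right x) u v
  have h₁ : inner ℝ v (A u) = inner ℝ u (A v) := by
    rw [real_inner_comm, hA.inner_left_eq_inner_right]
  simp only [B, LinearMap.mk₂_apply, h₁] at h
  rwa [sq]

theorem opTrace_nonneg (e : HilbertBasis ι ℝ H) {A : H →L[ℝ] H} (hA : A.IsPositive) :
    0 ≤ opTrace e A :=
  tsum_nonneg fun i => hA.inner_nonneg_right (e i)

/-- Parseval and Cauchy–Schwarz for the form of `A` give ‖Av‖² = ∑ ⟨eᵢ, Av⟩² ≤ tr(A) ⟨v, Av⟩ ≤ tr(A)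
‖v‖ ‖Av‖. -/
theorem norm_le_opTrace (e : HilbertBasis ι ℝ H) {A : H →L[ℝ] H} (hA : A.IsPositive)
    (htr : FiniteTrace e A) : ‖A‖ ≤ opTrace e A := by
  refine A.opNorm_le_bound (opTrace_nonneg e hA) fun v => ?_
  have h₁ : ‖A v‖ ^ 2 ≤ opTrace e A * inner ℝ v (A v) := by
    rw [← real_inner_self_eq_norm_sq, ← e.tsum_inner_mul_inner (A v) (A v), opTrace,
      ← tsum_mul_right]
    refine (e.summable_inner_mul_inner (A v) (A v)).tsum_le_tsum (fun i => ?_)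
      (Summable.mul_right _ htr)
    rw [real_inner_comm, ← sq]
    exact hA.inner_sq_le (e i) v
  have h₂ : inner ℝ v (A v) ≤ ‖v‖ * ‖A v‖ := real_inner_le_norm _ _
  have h₃ : ‖A v‖ * ‖A v‖ ≤ opTrace e A * ‖v‖ * ‖A v‖ := by
    nlinarith [mul_le_mul_of_nonneg_left h₂ (opTrace_nonneg e hA)]
  rcases (norm_nonneg (A v)).eq_or_lt with h | h
  · rw [← h]
    exact mul_nonneg (opTrace_nonneg e hA) (norm_nonneg _)
  · exact le_of_mul_le_mul_right h₃ h

end Trace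

/-- Leibniz rule for the bilinear form ⟨u, Av⟩: each product of derivatives is at most c^s D², and
the binomial coefficients sum to 2^s. -/
theorem norm_iteratedFDeriv_inner_apply_le {V H : Type*} [NormedAddCommGroup V] [NormedSpace ℝ V]
    [NormedAddCommGroup H] [InnerProductSpace ℝ H] {s : ℕ} {φ : V → H} (hφ : ContDiff ℝ s φ)
    (A : H →L[ℝ] H) {c D : ℝ} (hc : 0 ≤ c) {x : V}
    (hD : ∀ n ≤ s, ‖iteratedFDeriv ℝ n φ x‖ ≤ c ^ n * D) :
    ‖iteratedFDeriv ℝ s (fun x => inner ℝ (φ x) (A (φ x))) x‖ ≤ c ^ s * (2 ^ s * D ^ 2 * ‖A‖) := by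
  have hD₀ : 0 ≤ D := by simpa using (norm_nonneg _).trans (hD 0 (Nat.zero_le _))
  set B : H →L[ℝ] H →L[ℝ] ℝ := (innerSL ℝ).flip.comp A |>.flip
  have hB : ∀ u v, B u v = inner ℝ u (A v) := fun u v => rfl
  have hBn : ‖B‖ ≤ ‖A‖ := by
    refine ContinuousLinearMap.opNorm_le_bound₂ _ (norm_nonneg _) fun u v => ?_
    rw [hB, mul_comm ‖A‖, mul_assoc]
    exact (norm_inner_le_norm _ _).trans
      (mul_le_mul_of_nonneg_left (A.le_opNorm v) (norm_nonneg _))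
  refine (B.norm_iteratedFDeriv_le_of_bilinear hφ hφ x le_rfl).trans ?_
  calc ‖B‖ * ∑ i ∈ Finset.range (s + 1), (s.choose i : ℝ) * ‖iteratedFDeriv ℝ i φ x‖ *
        ‖iteratedFDeriv ℝ (s - i) φ x‖
      ≤ ‖A‖ * ∑ i ∈ Finset.range (s + 1), (s.choose i : ℝ) * (c ^ s * D ^ 2) := by
        refine mul_le_mul hBn (Finset.sum_le_sum fun i hi => ?_) (by positivity) (by positivity)
        have hi' : i ≤ s := Nat.lt_succ_iff.1 (Finset.mem_range.1 hi)
        rw [mul_assoc]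
        refine mul_le_mul_of_nonneg_left ?_ (Nat.cast_nonneg _)
        calc _ ≤ (c ^ i * D) * (c ^ (s - i) * D) :=
              mul_le_mul (hD i hi') (hD _ (Nat.sub_le _ _)) (norm_nonneg _) (by positivity)
          _ = c ^ s * D ^ 2 := by
              conv_rhs => rw [← Nat.add_sub_cancel' hi', pow_add]
              ring
    _ = c ^ s * (2 ^ s * D ^ 2 * ‖A‖) := by
        rw [← Finset.sum_mul, ← Nat.cast_sum, Nat.sum_range_choose]
        push_cast
        ring

/-! ### Markov's inequality at an endpoint. -/

section Markov

open Polynomial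

/-- Chebyshev polynomials are extremal, and T_n'(1) = n². -/
theorem eval_one_derivative_le {n : ℕ} {P : ℝ[X]} (hP : P.natDegree ≤ n)
    (h : ∀ x ∈ Set.Icc (-1 : ℝ) 1, |P.eval x| ≤ 1) : (derivative P).eval 1 ≤ (n : ℝ) ^ 2 := by
  have h₁ := Polynomial.Chebyshev.eval_iterate_derivative_le_of_forall_abs_le_one (k := 1)
    (le_refl (1 : ℝ)) (natDegree_le_iff_degree_le.1 hP) h
  simpa [Polynomial.Chebyshev.derivative_T_eval_one] using h₁

/-- Markov's inequality at the left endpoint of an interval. -/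
theorem abs_eval_derivative_left_le {n : ℕ} {q : ℝ[X]} (hq : q.natDegree ≤ n) {a b M : ℝ}
    (hab : a < b) (hM : 0 < M) (h : ∀ x ∈ Set.Icc a b, |q.eval x| ≤ M) :
    |(derivative q).eval a| ≤ 2 * n ^ 2 / (b - a) * M := by
  have hba : 0 < b - a := sub_pos.2 hab
  -- A decreasing affine map sends [-1, 1] to [a, b] and 1 to `a`. Both signs of `c` are needed
  -- because the bound at 1 is one-sided.
  have key : ∀ c : ℝ, |c| = M⁻¹ → c * (derivative q).eval a * (-((b - a) / 2)) ≤ (n : ℝ) ^ 2 := by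
    intro c hc
    have h₀ : (C ((a + b) / 2) + C (-((b - a) / 2)) * X).natDegree ≤ 1 := by
      rw [natDegree_C_add]
      exact (natDegree_C_mul_le _ _).trans natDegree_X_le
    have h₁ : (C c * q.comp (C ((a + b) / 2) + C (-((b - a) / 2)) * X)).natDegree ≤ n := by
      refine (natDegree_C_mul_le _ _).trans (natDegree_comp_le.trans ?_)
      exact (Nat.mul_le_mul hq h₀).trans (by simp)
    have h₂ := eval_one_derivative_le h₁ fun x hx => by
      have h₃ := h ((a + b) / 2 + -((b - a) / 2) * x)
        ⟨by nlinarith [hx.1, hx.2], by nlinarith [hx.1, hx.2]⟩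
      simp only [eval_mul, eval_C, eval_comp, eval_add, eval_X, abs_mul, hc]
      rw [inv_mul_le_iff₀ hM, mul_one]
      exact h₃
    have h₃ : (a + b) / 2 + -((b - a) / 2) = a := by ring
    have h₄ : derivative (C c * q.comp (C ((a + b) / 2) + C (-((b - a) / 2)) * X)) =
        C c * (C (-((b - a) / 2)) * (derivative q).comp
          (C ((a + b) / 2) + C (-((b - a) / 2)) * X)) := by
      rw [derivative_C_mul, derivative_comp]
      simp
    rw [h₄] at h₂
    simp only [eval_mul, eval_C, eval_comp, eval_add, eval_X, mul_one, h₃] at h₂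
    linarith
  have h₁ := key M⁻¹ (abs_of_pos (inv_pos.2 hM))
  have h₂ := key (-M⁻¹) (by rw [abs_neg, abs_of_pos (inv_pos.2 hM)])
  have h₃ : |(derivative q).eval a| * (M⁻¹ * ((b - a) / 2)) ≤ (n : ℝ) ^ 2 := by
    rcases abs_cases ((derivative q).eval a) with h | h <;> rw [h.1] <;> linarith
  rw [← mul_assoc, ← div_eq_mul_inv, ← mul_div_assoc, div_le_iff₀ two_pos, div_mul_eq_mul_div,
    div_le_iff₀ hM] at h₃
  rw [div_mul_eq_mul_div, le_div_iff₀ hba]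
  linarith

/-- A polynomial of degree at most `n` attaining its maximum modulus on `[0, 1]` at `0` stays
large near `0`. -/
theorem abs_eval_zero_le_two_mul {n : ℕ} (hn : 1 ≤ n) {q : ℝ[X]} (hq : q.natDegree ≤ n)
    (h : ∀ u ∈ Set.Icc (0 : ℝ) 1, |q.eval u| ≤ |q.eval 0|) :
    |q.eval 0| ≤ 2 * |q.eval (1 / (9 * (n : ℝ) ^ 2))| := by
  rcases (abs_nonneg (q.eval 0)).eq_or_lt with h₀ | h₀
  · rw [← h₀]
    positivity
  have hn' : (1 : ℝ) ≤ (n : ℝ) ^ 2 := one_le_pow₀ (by exact_mod_cast hn)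
  set t : ℝ := 1 / (9 * (n : ℝ) ^ 2) with ht
  have ht₀ : 0 ≤ t := by positivity
  have ht₁ : t ≤ 1 / 9 := by
    rw [ht]
    exact one_div_le_one_div_of_le (by norm_num) (by linarith)
  have htn : t * (n : ℝ) ^ 2 = 1 / 9 := by
    rw [ht]
    field_simp
  -- For u in [0, t], Markov on [u, 1] bounds |q'(u)| by 2n²/(1 - u) · |q(0)|, and 1 - u ≥ 8/9 gives
  -- the 9/4. Over length `t` the change is at most |q(0)|/4.
  have h₁ := Convex.norm_image_sub_le_of_norm_hasDerivWithin_le (f := fun u => q.eval u)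
    (f' := fun u => (derivative q).eval u) (s := Set.Icc 0 t)
    (C := 9 / 4 * (n : ℝ) ^ 2 * |q.eval 0|) (x := 0) (y := t)
    (fun u _ => (q.hasDerivAt u).hasDerivWithinAt) (fun u hu => by
      refine (abs_eval_derivative_left_le hq (b := 1) (by linarith [hu.2]) h₀
        fun x hx => h x ⟨hu.1.trans hx.1, hx.2⟩).trans ?_
      refine mul_le_mul_of_nonneg_right ?_ h₀.le
      rw [div_le_iff₀ (by linarith [hu.2])]
      nlinarith [hu.2]) (convex_Icc _ _) ⟨le_rfl, ht₀⟩ ⟨ht₀, le_rfl⟩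
  rw [Real.norm_eq_abs, Real.norm_eq_abs, sub_zero, abs_of_nonneg ht₀] at h₁
  have h₂ : 9 / 4 * (n : ℝ) ^ 2 * |q.eval 0| * t = 1 / 4 * |q.eval 0| := by
    linear_combination 9 / 4 * |q.eval 0| * htn
  rw [h₂] at h₁
  have h₃ := abs_sub_abs_le_abs_sub (q.eval 0) (q.eval t)
  rw [abs_sub_comm] at h₃
  linarith

end Markov

/-! ### Taylor polynomials and their restrictions to lines. -/

section Taylor

variable {V : Type*} [NormedAddCommGroup V] [NormedSpace ℝ V]

/-- In the multilinear expansion, the set `T` of slots receiving `t • b` contributes in degree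
`T.card`. -/
theorem ContinuousMultilinearMap.exists_polynomial_line {n : ℕ}
    (m : ContinuousMultilinearMap ℝ (fun _ : Fin n => V) ℝ) (a b : V) :
    ∃ q : Polynomial ℝ, q.natDegree ≤ n ∧ ∀ t, q.eval t = m fun _ => a + t • b := by
  refine ⟨∑ T : Finset (Fin n),
    Polynomial.monomial T.card (m (T.piecewise (fun _ => b) fun _ => a)), ?_, fun t => ?_⟩
  · refine Polynomial.natDegree_sum_le_of_forall_le _ _ fun T _ => ?_
    exact (Polynomial.natDegree_monomial_le _).trans (by simpa using T.card_le_univ)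
  · have h₁ : (fun _ : Fin n => a + t • b) = (fun _ => t • b) + fun _ => a := by
      funext i
      exact add_comm _ _
    rw [h₁, m.map_add_univ, Polynomial.eval_finsetSum]
    refine Finset.sum_congr rfl fun T _ => ?_
    have h₂ : T.piecewise (fun _ => t • b) (fun _ => a) =
        T.piecewise (fun i => t • (T.piecewise (fun _ => b) (fun _ => a) : Fin n → V) i)
          (T.piecewise (fun _ => b) (fun _ => a)) := by
      funext i
      by_cases hi : i ∈ T <;> simp [hi]
    rw [h₂, m.map_piecewise_smul (fun _ => t)]
    simp [mul_comm]

/-- The Taylor polynomial of degree at most `n` of `f` at `x`. -/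
noncomputable def taylorPoly (n : ℕ) (f : V → ℝ) (x z : V) : ℝ :=
  ∑ k ∈ Finset.range (n + 1), (k.factorial : ℝ)⁻¹ • iteratedFDeriv ℝ k f x fun _ => z - x

theorem continuous_taylorPoly (n : ℕ) (f : V → ℝ) (x : V) : Continuous (taylorPoly n f x) := by
  unfold taylorPoly
  fun_prop

theorem taylorPoly_self (n : ℕ) (f : V → ℝ) (x : V) : taylorPoly n f x x = f x := by
  rw [taylorPoly, Finset.sum_eq_single 0]
  · simp
  · intro k _ hk
    have : Nonempty (Fin k) := ⟨⟨0, Nat.pos_of_ne_zero hk⟩⟩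
    rw [sub_self, (iteratedFDeriv ℝ k f x).map_coord_zero (Classical.arbitrary _) rfl, smul_zero]
  · simp

theorem exists_polynomial_taylorPoly (n : ℕ) (f : V → ℝ) (x y v : V) :
    ∃ q : Polynomial ℝ, q.natDegree ≤ n ∧ ∀ t, q.eval t = taylorPoly n f x (y + t • v) := by
  choose q hq hq' using fun k =>
    (iteratedFDeriv ℝ k f x).exists_polynomial_line (y - x) v
  refine ⟨∑ k ∈ Finset.range (n + 1), Polynomial.C (k.factorial : ℝ)⁻¹ * q k, ?_, fun t => ?_⟩
  · refine Polynomial.natDegree_sum_le_of_forall_le _ _ fun k hk => ?_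
    exact (Polynomial.natDegree_C_mul_le _ _).trans
      ((hq k).trans (Nat.lt_succ_iff.1 (Finset.mem_range.1 hk)))
  · rw [Polynomial.eval_finsetSum, taylorPoly]
    refine Finset.sum_congr rfl fun k _ => ?_
    rw [Polynomial.eval_mul, Polynomial.eval_C, hq', smul_eq_mul, add_sub_right_comm]

theorem abs_sub_taylorPoly_le {n : ℕ} {f : V → ℝ} (hf : ContDiff ℝ (n + 1 : ℕ) f) {x z : V}
    {B : ℝ} (hB : ∀ u ∈ Set.Icc (0 : ℝ) 1, ‖iteratedFDeriv ℝ (n + 1) f (x + u • (z - x))‖ ≤ B) :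
    |f z - taylorPoly n f x z| ≤ B * ‖z - x‖ ^ (n + 1) / (n + 1).factorial := by
  have h₁ := map_add_eq_sum_add_integral_iteratedFDeriv (f := f) (x := x) (y := z - x) (n := n)
    fun t _ => hf.contDiffAt
  rw [add_sub_cancel] at h₁
  rw [taylorPoly, h₁, add_sub_cancel_left]
  have h₂ : ‖∫ t in (0 : ℝ)..1, (1 - t) ^ n •
      iteratedFDeriv ℝ (n + 1) f (x + t • (z - x)) (fun _ => z - x)‖ ≤
      ∫ t in (0 : ℝ)..1, (1 - t) ^ n * (B * ‖z - x‖ ^ (n + 1)) := by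
    refine intervalIntegral.norm_integral_le_of_norm_le zero_le_one
      (Eventually.of_forall fun t ht => ?_) (Continuous.intervalIntegrable (by fun_prop) _ _)
    rw [norm_smul, norm_pow, Real.norm_of_nonneg (sub_nonneg.2 ht.2)]
    refine mul_le_mul_of_nonneg_left ?_ (pow_nonneg (sub_nonneg.2 ht.2) _)
    refine (ContinuousMultilinearMap.le_opNorm _ _).trans ?_
    rw [Finset.prod_const, Finset.card_univ, Fintype.card_fin]
    exact mul_le_mul_of_nonneg_right (hB t ⟨ht.1.le, ht.2⟩) (by positivity)
  have h₃ : ∫ t in (0 : ℝ)..1, (1 - t) ^ n * (B * ‖z - x‖ ^ (n + 1)) =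
      B * ‖z - x‖ ^ (n + 1) / (n + 1) := by
    rw [intervalIntegral.integral_mul_const,
      intervalIntegral.integral_comp_sub_left (fun t => t ^ n) 1]
    simp
    ring
  rw [smul_eq_mul, abs_mul, abs_of_pos (by positivity : (0 : ℝ) < (n.factorial : ℝ)⁻¹),
    Nat.factorial_succ]
  rw [h₃, Real.norm_eq_abs] at h₂
  calc _ ≤ (n.factorial : ℝ)⁻¹ * (B * ‖z - x‖ ^ (n + 1) / (n + 1)) := by gcongr
    _ = _ := by push_cast; field_simp

end Taylor

/-! ### Norming sets and sampling on a ball. -/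

section ScatteredPoints

variable {V : Type*} [NormedAddCommGroup V] [NormedSpace ℝ V]

/-- The homothety of centre `x` and ratio ρ/r maps the large ball into itself. -/
theorem exists_closedBall_subset_closedBall {x c : V} {r ρ : ℝ} (hx : x ∈ Metric.closedBall c r)
    (hρ : 0 < ρ) (hρr : ρ ≤ r) :
    ∃ c', x ∈ Metric.closedBall c' ρ ∧ Metric.closedBall c' ρ ⊆ Metric.closedBall c r := by
  have hr : 0 < r := hρ.trans_le hρr
  rw [mem_closedBall_iff_norm] at hx
  have ht : 0 ≤ 1 - ρ / r := sub_nonneg.2 ((div_le_one hr).2 hρr)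
  refine ⟨x + (ρ / r) • (c - x), ?_, Metric.closedBall_subset_closedBall' ?_⟩
  · rw [mem_closedBall_iff_norm', add_sub_cancel_left, norm_smul,
      Real.norm_of_nonneg (by positivity), norm_sub_rev]
    calc ρ / r * ‖x - c‖ ≤ ρ / r * r := by gcongr
      _ = ρ := by field_simp
  · have : x + (ρ / r) • (c - x) - c = (1 - ρ / r) • (x - c) := by module
    rw [dist_eq_norm, this, norm_smul, Real.norm_of_nonneg ht]
    calc ρ + (1 - ρ / r) * ‖x - c‖ ≤ ρ + (1 - ρ / r) * r := by gcongr
      _ = r := by field_simp; ring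

/-- Sufficiently dense points of a ball form a norming set for polynomials. -/
theorem exists_abs_le_mul_abs_of_polynomial [ProperSpace V] {n M : ℕ} {κ t ρ : ℝ} (ht : 0 < t)
    (ht₁ : t ≤ 1) (hρ : 0 ≤ ρ)
    (hκ : ∀ q : Polynomial ℝ, q.natDegree ≤ n →
      (∀ u ∈ Set.Icc (0 : ℝ) 1, |q.eval u| ≤ |q.eval 0|) → |q.eval 0| ≤ κ * |q.eval t|)
    {P : V → ℝ} (hP : Continuous P)
    (hPl : ∀ y v, ∃ q : Polynomial ℝ, q.natDegree ≤ n ∧ ∀ t, q.eval t = P (y + t • v))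
    {c : V} {X : Fin M → V} (hX : ∀ w ∈ Metric.closedBall c ρ, ∃ m, ‖w - X m‖ ≤ t * ρ) :
    ∃ m, X m ∈ Metric.closedBall c ρ ∧ ∀ x ∈ Metric.closedBall c ρ, |P x| ≤ κ * |P (X m)| := by
  obtain ⟨y, hy, hmax⟩ := (isCompact_closedBall c ρ).exists_isMaxOn
    ⟨c, Metric.mem_closedBall_self hρ⟩ hP.abs.continuousOn
  have hconv := convex_closedBall c ρ
  have hc : c ∈ Metric.closedBall c ρ := Metric.mem_closedBall_self hρ
  -- Choose a sample within tρ of the point a fraction `t` of the way from the maximiser `y` to the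
  -- centre. Prolonging from `y` through `X m` by the factor t⁻¹ ends within ρ of `c`, so the whole
  -- segment lies in the ball and meets `X m` at parameter `t`.
  obtain ⟨m, hm⟩ := hX (y + t • (c - y)) (hconv.add_smul_sub_mem hy hc ⟨ht.le, ht₁⟩)
  have hv : y + t⁻¹ • (X m - y) ∈ Metric.closedBall c ρ := by
    have h₁ : y + t⁻¹ • (X m - y) - c = t⁻¹ • (X m - (y + t • (c - y))) := by
      rw [← sub_sub (X m), smul_sub t⁻¹ (X m - y), inv_smul_smul₀ ht.ne']
      abel
    rw [mem_closedBall_iff_norm, h₁, norm_smul, Real.norm_of_nonneg (by positivity), norm_sub_rev,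
      inv_mul_le_iff₀ ht]
    exact hm
  obtain ⟨q, hq, hq'⟩ := hPl y (t⁻¹ • (X m - y))
  have hseg : ∀ u ∈ Set.Icc (0 : ℝ) 1,
      y + u • t⁻¹ • (X m - y) ∈ Metric.closedBall c ρ := by
    intro u hu
    simpa using hconv.add_smul_sub_mem hy hv hu
  have hXm : y + t • t⁻¹ • (X m - y) = X m := by
    rw [smul_inv_smul₀ ht.ne']
    abel
  have h₁ := hκ q hq fun u hu => by
    rw [hq', hq', zero_smul, add_zero]
    exact hmax (hseg u hu)
  rw [hq', hq', zero_smul, add_zero, hXm] at h₁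
  refine ⟨m, ?_, fun x hx => (hmax hx).trans h₁⟩
  rw [← hXm]
  exact hseg t ⟨ht.le, ht₁⟩

/-- Sampling inequality on a ball. -/
theorem abs_le_of_abs_le_on_samples [ProperSpace V] {n M : ℕ} {κ t ρ : ℝ} (ht : 0 < t)
    (ht₁ : t ≤ 1) (hρ : 0 ≤ ρ) (hκ₀ : 0 ≤ κ)
    (hκ : ∀ q : Polynomial ℝ, q.natDegree ≤ n →
      (∀ u ∈ Set.Icc (0 : ℝ) 1, |q.eval u| ≤ |q.eval 0|) → |q.eval 0| ≤ κ * |q.eval t|)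
    {f : V → ℝ} (hf : ContDiff ℝ (n + 1 : ℕ) f) {c : V} {B : ℝ}
    (hB : ∀ z ∈ Metric.closedBall c ρ, ‖iteratedFDeriv ℝ (n + 1) f z‖ ≤ B)
    {X : Fin M → V} (hX : ∀ w ∈ Metric.closedBall c ρ, ∃ m, ‖w - X m‖ ≤ t * ρ) {τ : ℝ}
    (hτ : ∀ m, |f (X m)| ≤ τ) {x : V} (hx : x ∈ Metric.closedBall c ρ) :
    |f x| ≤ κ * (τ + B * (2 * ρ) ^ (n + 1) / (n + 1).factorial) := by
  -- Expanding at the target `x` makes the polynomial equal f(x) there, so a Taylor error occurs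
  -- only at `X m`.
  obtain ⟨m, hm, hmax⟩ := exists_abs_le_mul_abs_of_polynomial ht ht₁ hρ hκ
    (continuous_taylorPoly n f x) (exists_polynomial_taylorPoly n f x) hX
  have h₁ := hmax x hx
  rw [taylorPoly_self] at h₁
  refine h₁.trans (mul_le_mul_of_nonneg_left ?_ hκ₀)
  have hB₀ : 0 ≤ B := (norm_nonneg _).trans (hB x hx)
  have h₂ := abs_sub_taylorPoly_le hf (x := x) (z := X m) (B := B) fun u hu =>
    hB _ ((convex_closedBall c ρ).add_smul_sub_mem hx hm hu)
  have h₃ : ‖X m - x‖ ≤ 2 * ρ := by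
    have h₄ := dist_triangle_right (X m) x c
    rw [dist_eq_norm] at h₄
    linarith [Metric.mem_closedBall.1 hm, Metric.mem_closedBall.1 hx]
  have h₄ : B * ‖X m - x‖ ^ (n + 1) / (n + 1).factorial ≤
      B * (2 * ρ) ^ (n + 1) / (n + 1).factorial := by gcongr
  have h₅ := abs_sub_abs_le_abs_sub (taylorPoly n f x (X m)) (f (X m))
  rw [abs_sub_comm] at h₅
  linarith [hτ m]

end ScatteredPoints

/-! ### Fill distance. -/

section FillDistance

variable {d M : ℕ}

/-- The finitely many closed balls of radius h around the samples cover Ω, and their union is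
closed. -/
theorem exists_norm_sub_le_fillDistance (hM : 0 < M) (X : Fin M → Rd d) {Ω : Set (Rd d)}
    (hΩ : Bornology.IsBounded Ω) {w : Rd d} (hw : w ∈ closure Ω) :
    ∃ m, ‖w - X m‖ ≤ fillDistance X Ω := by
  have : Nonempty (Fin M) := ⟨⟨0, hM⟩⟩
  have hbdd : BddAbove ((fun x => ⨅ m, ‖x - X m‖) '' Ω) := by
    obtain ⟨R, hR⟩ := hΩ.subset_closedBall (X ⟨0, hM⟩)
    refine ⟨R, ?_⟩
    rintro _ ⟨x, hx, rfl⟩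
    exact (ciInf_le (f := fun m => ‖x - X m‖) (Set.finite_range _).bddBelow ⟨0, hM⟩).trans
      (mem_closedBall_iff_norm.1 (hR hx))
  have hcl : IsClosed (⋃ m, Metric.closedBall (X m) (fillDistance X Ω)) :=
    isClosed_iUnion_of_finite fun m => Metric.isClosed_closedBall
  have hsub : Ω ⊆ ⋃ m, Metric.closedBall (X m) (fillDistance X Ω) := by
    intro x hx
    obtain ⟨m, hm⟩ := exists_eq_ciInf_of_finite (f := fun m => ‖x - X m‖)
    refine Set.mem_iUnion.2 ⟨m, mem_closedBall_iff_norm.2 ?_⟩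
    rw [hm]
    exact le_csSup hbdd ⟨x, hx, rfl⟩
  obtain ⟨m, hm⟩ := Set.mem_iUnion.1 (closure_minimal hsub hcl hw)
  exact ⟨m, mem_closedBall_iff_norm.1 hm⟩

theorem fillDistance_nonneg (X : Fin M → Rd d) (Ω : Set (Rd d)) : 0 ≤ fillDistance X Ω := by
  refine Real.sSup_nonneg ?_
  rintro _ ⟨x, -, rfl⟩
  exact Real.iInf_nonneg fun m => norm_nonneg _

end FillDistance

/-! ### Finiteness of the suprema, and bounds up to the closure. -/

section Suprema

variable {d : ℕ}

theorem IsCompact.bddAbove_abs_family {E β : Type*} [TopologicalSpace E] {K : Set E}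
    (hK : IsCompact K) {I : Set β} (hI : I.Finite) {F : β → E → ℝ}
    (hF : ∀ i ∈ I, Continuous (F i)) :
    BddAbove {t | ∃ x ∈ K, ∃ i ∈ I, t = |F i x|} := by
  refine (hI.bddAbove_biUnion (S := fun i => (fun x => |F i x|) '' K)).2
    (fun i hi => hK.bddAbove_image (hF i hi).abs.continuousOn) |>.mono ?_
  rintro _ ⟨x, hx, i, hi, rfl⟩
  exact Set.mem_biUnion hi ⟨x, hx, rfl⟩

theorem finite_multiIndex_le (d s : ℕ) : {α : Fin d → ℕ | ∑ i, α i ≤ s}.Finite := by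
  refine (Set.finite_Iic fun _ : Fin d => s).subset fun α hα i => ?_
  exact (Finset.single_le_sum (fun _ _ => Nat.zero_le _) (Finset.mem_univ i)).trans hα

theorem derivSeminorm_nonneg (Ω : Set (Rd d)) (s : ℕ) (g : Rd d → ℝ) :
    0 ≤ derivSeminorm Ω s g := by
  refine Real.sSup_nonneg ?_
  rintro _ ⟨x, -, α, -, rfl⟩
  exact abs_nonneg _

theorem kernelDerivBoundSq_nonneg (Ω : Set (Rd d)) (s : ℕ) (k : Rd d → Rd d → ℝ) :
    0 ≤ kernelDerivBoundSq Ω s k := by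
  refine Real.sSup_nonneg ?_
  rintro _ ⟨x, -, y, -, α, -, rfl⟩
  exact abs_nonneg _

theorem abs_partialDeriv_le_derivSeminorm {s : ℕ} {g : Rd d → ℝ} (hg : ContDiff ℝ s g)
    {Ω : Set (Rd d)} (hΩ : Bornology.IsBounded Ω) {α : Fin d → ℕ} (hα : ∑ i, α i = s)
    {x : Rd d} (hx : x ∈ closure Ω) : |partialDeriv α g x| ≤ derivSeminorm Ω s g := by
  have hbdd := (hΩ.isCompact_closure.bddAbove_abs_family (I := {α : Fin d → ℕ | ∑ i, α i = s})
    (F := fun α => partialDeriv α g) ((finite_multiIndex_le d s).subset fun α hα => le_of_eq hα)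
    fun α hα => continuous_partialDeriv hg hα).mono
    (s := {t | ∃ x ∈ Ω, ∃ α : Fin d → ℕ, ∑ i, α i = s ∧ t = |partialDeriv α g x|})
    (by rintro t ⟨x, hx, h⟩; exact ⟨x, subset_closure hx, h⟩)
  refine closure_minimal (fun y hy => ?_)
    (isClosed_le (continuous_partialDeriv hg hα).abs continuous_const) hx
  exact le_csSup hbdd ⟨y, hy, α, hα, rfl⟩

theorem abs_diagDeriv_le_kernelDerivBoundSq {s : ℕ} {k : Rd d → Rd d → ℝ} (hk : IsDiagC s k)
    {Ω : Set (Rd d)} (hΩ : Bornology.IsBounded Ω) {α : Fin d → ℕ} (hα : ∑ i, α i ≤ s)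
    {x : Rd d} (hx : x ∈ closure Ω) : |diagDeriv α k (x, x)| ≤ kernelDerivBoundSq Ω s k := by
  have hbdd := ((hΩ.isCompact_closure.prod hΩ.isCompact_closure).bddAbove_abs_family
    (F := fun α => diagDeriv α k) (finite_multiIndex_le d s) fun α hα => (hk α hα).2).mono
    (s := {t | ∃ x ∈ Ω, ∃ y ∈ Ω, ∃ α : Fin d → ℕ, ∑ i, α i ≤ s ∧ t = |diagDeriv α k (x, y)|})
    (by rintro t ⟨x, hx, y, hy, h⟩; exact ⟨(x, y), ⟨subset_closure hx, subset_closure hy⟩, h⟩)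
  have hc : Continuous fun x => diagDeriv α k (x, x) :=
    (hk α hα).2.comp (by fun_prop : Continuous fun x : Rd d => (x, x))
  refine closure_minimal (fun y hy => ?_) (isClosed_le hc.abs continuous_const) hx
  exact le_csSup hbdd ⟨y, hy, y, hy, α, hα, rfl⟩

theorem norm_iteratedFDeriv_le_derivSeminorm {s : ℕ} {g : Rd d → ℝ} (hg : ContDiff ℝ s g)
    {Ω : Set (Rd d)} (hΩ : Bornology.IsBounded Ω) {x : Rd d} (hx : x ∈ closure Ω) :
    ‖iteratedFDeriv ℝ s g x‖ ≤ √d ^ s * derivSeminorm Ω s g := by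
  refine ContinuousMultilinearMap.norm_le_of_single _ (derivSeminorm_nonneg _ _ _) fun i => ?_
  obtain ⟨α, hα, h⟩ := exists_iteratedFDeriv_single_eq_partialDeriv hg i
  rw [h, Real.norm_eq_abs]
  exact abs_partialDeriv_le_derivSeminorm hg hΩ hα hx

end Suprema

/-! ### Derivative bounds for the model and its residual. -/

section RKHS

variable {d : ℕ} {H : Type*} [NormedAddCommGroup H] [InnerProductSpace ℝ H] [CompleteSpace H]
  [RKHS ℝ H (Rd d) ℝ]

theorem scalarKernel_eq_inner_featureMap :
    scalarKernel H = fun x y => inner ℝ (featureMap H x) (featureMap H y) :=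
  funext₂ (scalarKernel_eq_inner H)

theorem contDiff_featureMap {s : ℕ} (hk : IsDiagC s (scalarKernel H)) :
    ContDiff ℝ s (featureMap H : Rd d → H) := by
  rw [scalarKernel_eq_inner_featureMap] at hk
  exact (contDiff_of_isDiagC hk).1

theorem norm_iteratedFDeriv_featureMap_le {s : ℕ} (hk : IsDiagC s (scalarKernel H))
    {Ω : Set (Rd d)} (hΩ : Bornology.IsBounded Ω) {x : Rd d} (hx : x ∈ closure Ω) {n : ℕ}
    (hn : n ≤ s) : ‖iteratedFDeriv ℝ n (featureMap H : Rd d → H) x‖ ≤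
      √d ^ n * √(kernelDerivBoundSq Ω s (scalarKernel H)) := by
  refine ContinuousMultilinearMap.norm_le_of_single _ (Real.sqrt_nonneg _) fun i => ?_
  have hk' := hk
  rw [scalarKernel_eq_inner_featureMap] at hk'
  obtain ⟨α, hα, h⟩ := (contDiff_of_isDiagC hk').2 n hn i
  refine Real.le_sqrt_of_sq_le ?_
  rw [h, ← scalarKernel_eq_inner_featureMap]
  exact (le_abs_self _).trans (abs_diagDeriv_le_kernelDerivBoundSq hk hΩ hα hx)

/-- The derivatives of the difference of `g` and the model `⟨φ, A φ⟩`. -/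
theorem norm_iteratedFDeriv_sub_inner_le {s : ℕ} (hk : IsDiagC s (scalarKernel H))
    {Ω : Set (Rd d)} (hΩ : Bornology.IsBounded Ω) {g : Rd d → ℝ} (hg : ContDiff ℝ s g)
    {A : H →L[ℝ] H} (hA : A.IsPositive) {ι : Type*} (e : HilbertBasis ι ℝ H)
    (htr : FiniteTrace e A) {x : Rd d} (hx : x ∈ closure Ω) :
    ‖iteratedFDeriv ℝ s (fun x => g x - inner ℝ (featureMap H x) (A (featureMap H x))) x‖ ≤
      √d ^ s * (derivSeminorm Ω s g
        + 2 ^ s * kernelDerivBoundSq Ω s (scalarKernel H) * opTrace e A) := by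
  have hφ := contDiff_featureMap hk
  have h₁ := norm_iteratedFDeriv_inner_apply_le hφ A (Real.sqrt_nonneg d)
    fun n hn => norm_iteratedFDeriv_featureMap_le hk hΩ hx hn
  rw [Real.sq_sqrt (kernelDerivBoundSq_nonneg _ _ _)] at h₁
  have hr : ContDiff ℝ s fun x => inner ℝ (featureMap H x) (A (featureMap H x)) :=
    hφ.inner ℝ (A.contDiff.comp hφ)
  rw [fun_iteratedFDeriv_sub_apply hg.contDiffAt hr.contDiffAt]
  refine (norm_sub_le _ _).trans ?_
  rw [mul_add]
  refine add_le_add (norm_iteratedFDeriv_le_derivSeminorm hg hΩ hx) (h₁.trans ?_)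
  have := kernelDerivBoundSq_nonneg Ω s (scalarKernel H)
  gcongr
  exact norm_le_opTrace e hA htr

end RKHS

/-! ### Geometry of unions of balls. -/

section UnionOfBalls

variable {d : ℕ} {S Ω : Set (Rd d)} {r : ℝ}

theorem isBounded_of_eq_iUnion_ball (hS : Bornology.IsBounded S)
    (hΩ : Ω = ⋃ x ∈ S, Metric.ball x r ∨ Ω = ⋃ x ∈ S, Metric.closedBall x r) :
    Bornology.IsBounded Ω := by
  refine (hS.cthickening (δ := r)).subset fun y hy => ?_
  have : ∃ x ∈ S, y ∈ Metric.closedBall x r := by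
    rcases hΩ with rfl | rfl
    · obtain ⟨x, hx, h⟩ := Set.mem_iUnion₂.1 hy
      exact ⟨x, hx, Metric.ball_subset_closedBall h⟩
    · simpa using hy
  obtain ⟨x, hx, h⟩ := this
  exact Metric.mem_cthickening_of_dist_le y x r S hx h

theorem exists_closedBall_subset_closure (hr : 0 < r)
    (hΩ : Ω = ⋃ x ∈ S, Metric.ball x r ∨ Ω = ⋃ x ∈ S, Metric.closedBall x r) {y : Rd d}
    (hy : y ∈ Ω) : ∃ c, y ∈ Metric.closedBall c r ∧ Metric.closedBall c r ⊆ closure Ω := by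
  rcases hΩ with rfl | rfl
  · obtain ⟨x, hx, h⟩ := Set.mem_iUnion₂.1 hy
    refine ⟨x, Metric.ball_subset_closedBall h, ?_⟩
    rw [← closure_ball x hr.ne']
    exact closure_mono (Set.subset_biUnion_of_mem (u := fun x => Metric.ball x r) hx)
  · obtain ⟨x, hx, h⟩ := Set.mem_iUnion₂.1 hy
    exact ⟨x, h, (Set.subset_biUnion_of_mem (u := fun x => Metric.closedBall x r) hx).trans
      subset_closure⟩

end UnionOfBalls

/-! ### Constants and the final assembly. -/

theorem scatterConst_one_bound (d : ℕ) : 2 * √d ≤ scatterConst d 1 := by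
  have h₁ : √(d : ℝ) ≤ d := by
    rw [Real.sqrt_le_left (Nat.cast_nonneg d)]
    exact_mod_cast Nat.le_self_pow two_ne_zero d
  have h₂ : scatterConst d 1 = 3 * d := by simp [scatterConst]
  have := Nat.cast_nonneg (α := ℝ) d
  rw [h₂]
  linarith

/-- The derivative bound supplies √d and the ball diameter 18n², while (3√(2d) n)² = 18dn²; the
slack is √d ≤ d and 2 ≤ 3. -/
theorem scatterConst_bound (d n : ℕ) :
    2 * (√d ^ (n + 1) * (18 * (n : ℝ) ^ 2) ^ (n + 1) / (n + 1).factorial) ≤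
      scatterConst d (n + 1) := by
  have h₁ : √(d : ℝ) ≤ d := by
    rw [Real.sqrt_le_left (Nat.cast_nonneg d)]
    exact_mod_cast Nat.le_self_pow two_ne_zero d
  have h₂ : √d * (18 * (n : ℝ) ^ 2) ≤
      max √d (3 * √(2 * d) * (((n + 1 : ℕ) : ℝ) - 1)) ^ 2 := by
    calc √d * (18 * (n : ℝ) ^ 2) ≤ d * (18 * (n : ℝ) ^ 2) := by gcongr
      _ = (3 * √(2 * d) * (((n + 1 : ℕ) : ℝ) - 1)) ^ 2 := by
        push_cast
        rw [mul_pow, mul_pow, Real.sq_sqrt (by positivity)]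
        ring
      _ ≤ _ := by
        refine pow_le_pow_left₀ ?_ (le_max_right _ _) 2
        push_cast
        rw [add_sub_cancel_right]
        positivity
  have h₃ := pow_le_pow_left₀ (by positivity) h₂ (n + 1)
  rw [← pow_mul, mul_pow] at h₃
  rw [scatterConst, ← mul_div_assoc]
  gcongr
  have : 0 ≤ √d ^ (n + 1) * (18 * (n : ℝ) ^ 2) ^ (n + 1) := by positivity
  linarith

/-- Sampling inequality on a union of balls. -/
theorem abs_le_of_fillDistance {d M n : ℕ} (hM : 0 < M) {S Ω : Set (Rd d)}
    (hS : Bornology.IsBounded S) {r : ℝ} (hr : 0 < r)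
    (hΩ : Ω = ⋃ x ∈ S, Metric.ball x r ∨ Ω = ⋃ x ∈ S, Metric.closedBall x r)
    {X : Fin M → Rd d} (hfill : fillDistance X Ω * max 1 (18 * (n : ℝ) ^ 2) ≤ r)
    {f : Rd d → ℝ} (hf : ContDiff ℝ (n + 1 : ℕ) f) {Q : ℝ}
    (hQ₀ : 0 ≤ Q) (hQ : ∀ z ∈ closure Ω, ‖iteratedFDeriv ℝ (n + 1) f z‖ ≤ √d ^ (n + 1) * Q) {τ : ℝ}
    (hτ : ∀ m, |f (X m)| ≤ τ) {x : Rd d} (hx : x ∈ Ω) :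
    |f x| ≤ scatterConst d (n + 1) * Q * fillDistance X Ω ^ (n + 1) + 2 * τ := by
  have hΩb := isBounded_of_eq_iUnion_ball hS hΩ
  have hτ₀ : 0 ≤ τ := (abs_nonneg _).trans (hτ ⟨0, hM⟩)
  have hcov : ∀ w ∈ closure Ω, ∃ m, ‖w - X m‖ ≤ fillDistance X Ω :=
    fun w hw => exists_norm_sub_le_fillDistance hM X hΩb hw
  have hh₀ := fillDistance_nonneg X Ω
  set h := fillDistance X Ω
  -- If h = 0, then `x` is itself a sample; otherwise the radii below are positive.
  rcases hh₀.eq_or_lt with h₀ | hpos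
  · obtain ⟨m, hm⟩ := hcov x (subset_closure hx)
    rw [← h₀] at hm ⊢
    rw [sub_eq_zero.1 (norm_le_zero_iff.1 hm), zero_pow n.succ_ne_zero, mul_zero, zero_add]
    linarith [hτ m]
  obtain ⟨c, hxc, hcΩ⟩ := exists_closedBall_subset_closure hr hΩ hx
  rcases Nat.eq_zero_or_pos n with rfl | hn
  · have hhr : h ≤ r := by simpa using hfill
    obtain ⟨c', hxc', hc'⟩ := exists_closedBall_subset_closedBall hxc hpos hhr
    have key := abs_le_of_abs_le_on_samples (n := 0) (κ := 1) one_pos le_rfl hh₀ zero_le_one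
      (fun q hq _ => by rw [Polynomial.eq_C_of_natDegree_le_zero hq]; simp) hf
      (fun z hz => hQ z (hcΩ (hc' hz))) (X := X)
      (fun w hw => by simpa using hcov w (hcΩ (hc' hw))) hτ hxc'
    refine key.trans ?_
    have h₁ := mul_le_mul_of_nonneg_right (scatterConst_one_bound d) (mul_nonneg hQ₀ hh₀)
    simp only [zero_add, pow_one, Nat.factorial_one, Nat.cast_one, div_one, one_mul]
    linarith
  · have hn₁ : (1 : ℝ) ≤ (n : ℝ) ^ 2 := one_le_pow₀ (by exact_mod_cast hn)
    have hn₂ : h * (18 * (n : ℝ) ^ 2) ≤ r :=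
      (mul_le_mul_of_nonneg_left (le_max_right _ _) hh₀).trans hfill
    -- The radius ρ = 9n²h makes tρ = h for t = 1/(9n²), and its diameter is 18n²h ≤ r.
    have hρ : 0 < h * (9 * (n : ℝ) ^ 2) := by positivity
    have hth : 1 / (9 * (n : ℝ) ^ 2) * (h * (9 * (n : ℝ) ^ 2)) = h := by field_simp
    obtain ⟨c', hxc', hc'⟩ := exists_closedBall_subset_closedBall hxc hρ (by nlinarith)
    have key := abs_le_of_abs_le_on_samples (n := n) (κ := 2) (t := 1 / (9 * (n : ℝ) ^ 2))
      (by positivity) ((div_le_one (by positivity)).2 (by linarith)) hρ.le zero_le_two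
      (fun q hq => abs_eval_zero_le_two_mul hn hq) hf
      (fun z hz => hQ z (hcΩ (hc' hz))) (X := X)
      (fun w hw => by rw [hth]; exact hcov w (hcΩ (hc' hw))) hτ hxc'
    refine key.trans ?_
    have h₁ := mul_le_mul_of_nonneg_right (scatterConst_bound d n)
      (mul_nonneg hQ₀ (pow_nonneg hh₀ (n + 1)))
    have h₂ : 2 * (h * (9 * (n : ℝ) ^ 2)) = 18 * (n : ℝ) ^ 2 * h := by ring
    rw [h₂, mul_pow _ h, mul_add, add_comm]
    refine add_le_add_left (le_trans (le_of_eq ?_) (h₁.trans_eq ?_)) _ <;> ring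


/- The condition `h ≤ r min(1, 1 / (18 (s-1)²))` is written `h max(1, 18 (s-1)²) ≤ r`,
which for `s = 1` reads `h ≤ r`. -/
theorem mainTheorem2 {d M s sφ : ℕ} (hs : 1 ≤ s) (hsφ : s ≤ sφ) (hM : 0 < M)
    -- the RKHS `H` on `ℝ^d`, whose kernel is of class `C^{sφ,sφ}`
    {H : Type*} [NormedAddCommGroup H] [InnerProductSpace ℝ H] [CompleteSpace H]
    [RKHS ℝ H (Rd d) ℝ] (hk : IsDiagC sφ (scalarKernel H))
    -- `Ω` is the union of the open balls, or of the closed balls, of radius `r` centered in `S`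
    (S : Set (Rd d)) (hS : Bornology.IsBounded S) (r : ℝ) (hr : 0 < r) (Ω : Set (Rd d))
    (hΩ : Ω = ⋃ x ∈ S, Metric.ball x r ∨ Ω = ⋃ x ∈ S, Metric.closedBall x r)
    -- the samples
    (X : Fin M → Rd d) (hX : ∀ m, X m ∈ Ω)
    (hfill : fillDistance X Ω * max 1 (18 * ((s : ℝ) - 1) ^ 2) ≤ r)
    (g : Rd d → ℝ) (hg : ContDiff ℝ s g)
    -- the positive semidefinite trace-class operator `A`
    (A : H →L[ℝ] H) (hA : A.IsPositive)
    {ι : Type*} (e : HilbertBasis ι ℝ H) (htr : FiniteTrace e A)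
    (τ : ℝ) (hτ : 0 ≤ τ)
    (happrox : ∀ m, |g (X m) - inner ℝ (featureMap H (X m)) (A (featureMap H (X m)))| ≤ τ) :
    ∀ x ∈ closure Ω,
      g x ≥ -(scatterConst d s *
          (derivSeminorm Ω s g
            + 2 ^ s * kernelDerivBoundSq Ω s (scalarKernel H) * opTrace e A)
          * fillDistance X Ω ^ s + 2 * τ) := by 
  obtain ⟨n, rfl⟩ : ∃ n, s = n + 1 := ⟨s - 1, by omega⟩
  have hk' : IsDiagC (n + 1) (scalarKernel H) := fun α hα => hk α (hα.trans hsφ)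
  have hΩb := isBounded_of_eq_iUnion_ball hS hΩ
  have hφ := contDiff_featureMap hk'
  have hQ₀ : 0 ≤ derivSeminorm Ω (n + 1) g
      + 2 ^ (n + 1) * kernelDerivBoundSq Ω (n + 1) (scalarKernel H) * opTrace e A := by
    have h₁ := derivSeminorm_nonneg Ω (n + 1) g
    have h₂ := kernelDerivBoundSq_nonneg Ω (n + 1) (scalarKernel H)
    have h₃ := opTrace_nonneg e hA
    positivity
  intro x hx
  refine closure_minimal (fun y hy => ?_) (isClosed_le continuous_const hg.continuous) hx
  have h₁ := abs_le_of_fillDistance (n := n) hM hS hr hΩ (X := X) (by simpa using hfill)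
    (f := fun x => g x - inner ℝ (featureMap H x) (A (featureMap H x)))
    (hg.sub (hφ.inner ℝ (A.contDiff.comp hφ))) hQ₀
    (fun z hz => norm_iteratedFDeriv_sub_inner_le hk' hΩb hg hA e htr hz) happrox hy
  -- Positivity of the model turns the lower bound on the residual into one on `g`.
  have h₂ : 0 ≤ inner ℝ (featureMap H y) (A (featureMap H y)) := hA.inner_nonneg_right _
  have h₃ := (abs_le.1 h₁).1
  change -(_ + _) ≤ g y
  linarith
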